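/- Let $(M^n,g)$ be an $n$-dimensional smooth Riemannian manifold (Hausdorff, second countable, without boundary) with Riemannian measure $dv_g$, let $u\in C^\infty(M)$ and $V=e^u$, let $\lambda,\mu\in\mathbb R$ and $\tau=(n+1)\lambda+\mu$. The affine gradient and the affine Laplacian of the connection $D^{\lambda,\mu}_XY=\nabla_XY+\lambda\,du(X)Y+\lambda\,du(Y)X+\mu\,g(X,Y)\nabla u$ are $$\nabla^Df=V^{\mu-\lambda}\nabla f,\qquad \Delta^Df=V^{\mu-\lambda}\big(\Delta f+(2\mu+n\lambda)\langle\nabla u,\nabla f\rangle\big).$$ Let $\rho\ge0$ be a continuous function on $M$, put $\Omega=M\setminus\rho^{-1}\{0\}$, and let $a\ge0$ be a function on $M$, such that $\rho,a\in W^{1,1}_{\rm loc}(\Omega)$; $\nabla\rho$ and $\nabla a$ denote their distributional gradients on $\Omega$. Let $C>1$ and $\alpha\in\mathbb R$ with $C+\alpha+1>0$, and assume that in the sense of distributions on $\Omega$ $$|\nabla^D\rho|=1,\qquad \Delta^D\rho\ge\frac C\rho V^{\lambda-\mu},\qquad \langle\nabla^D\rho,\nabla^Da\rangle\ge0,$$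 the first and third almost everywhere, and the second after pairing with any nonnegative $\psi\in C_0^\infty(\Omega)$ (where $\Delta\rho$ is the distribution $\chi\mapsto-\int_M\langle\nabla\rho,\nabla\chi\rangle\,dv_g$). Then for every $1<p<\infty$ and every real-valued $\phi\in C_0^\infty(\Omega)$ the three integrals below converge absolutely, and $$\int_M a\rho^{\alpha+p}|\langle\nabla^D\rho,\nabla^D\phi\rangle|^pV^{\tau+\lambda-\mu}\,dv_g\ \ge\ \Big(\frac{C+\alpha+1}p\Big)^{p}\int_M a\rho^\alpha|\phi|^pV^{\tau+\lambda-\mu}\,dv_g+\Big(\frac{C+\alpha+1}p\Big)^{p-1}\int_M\rho^{\alpha+1}|\phi|^p\langle\nabla^D\rho,\nabla^Da\rangle V^{\tau+\lambda-\mu}\,dv_g .$$ -/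

import Mathlib

open MeasureTheory
open scoped Manifold ContDiff ENNReal

noncomputable section

/-- A smooth Riemannian metric on the `n`-dimensional smooth manifold `M`. -/
abbrev SmoothMetric (n : ℕ) (M : Type*) [TopologicalSpace M]
    [ChartedSpace (EuclideanSpace ℝ (Fin n)) M] [IsManifold (𝓡 n) ∞ M] : Type _ :=
  Bundle.ContMDiffRiemannianMetric (𝓡 n) ∞ (EuclideanSpace ℝ (Fin n))
    (fun x : M => TangentSpace (𝓡 n) x)

namespace SmoothMetric

variable {n : ℕ} {M : Type*} [TopologicalSpace M]
  [ChartedSpace (EuclideanSpace ℝ (Fin n)) M] [IsManifold (𝓡 n) ∞ M]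

/-- The length `|v|` of a tangent vector. -/
def vnorm (g : SmoothMetric n M) (x : M) (v : TangentSpace (𝓡 n) x) : ℝ :=
  Real.sqrt (g.inner x v v)

/-- The tangent vector at `e.symm z` whose coordinate expression in the chart `e` is `v`. -/
def chartVector (e : OpenPartialHomeomorph M (EuclideanSpace ℝ (Fin n)))
    (z v : EuclideanSpace ℝ (Fin n)) : TangentSpace (𝓡 n) (e.symm z) :=
  mfderiv (𝓡 n) (𝓡 n) e.symm z v

/-- The matrix `(g_ij)` of the metric in the chart `e`, at the point with coordinates `z`. -/
def gram (g : SmoothMetric n M) (e : OpenPartialHomeomorph M (EuclideanSpace ℝ (Fin n)))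
    (z : EuclideanSpace ℝ (Fin n)) : Matrix (Fin n) (Fin n) ℝ :=
  Matrix.of fun i j => g.inner (e.symm z)
    (chartVector e z (EuclideanSpace.single i 1)) (chartVector e z (EuclideanSpace.single j 1))

/-- The Riemannian volume of the domain of the chart `e`, i.e. `√(det g_ij) dz` carried from the
target of the chart to `M`. -/
def chartVolume [MeasurableSpace M] (g : SmoothMetric n M)
    (e : OpenPartialHomeomorph M (EuclideanSpace ℝ (Fin n))) : Measure M :=
  Measure.map e.symm ((volume.restrict e.target).withDensity
    fun z => ENNReal.ofReal (Real.sqrt (g.gram e z).det))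

/-- The Riemannian volume measure `dv_g`: the smallest measure which dominates the measure
`√(det g_ij) dz` of each chart.  As these measures agree on overlaps of charts, it is the one
which restricts to each of them on the domain of the chart. -/
def vol [MeasurableSpace M] (g : SmoothMetric n M) : Measure M :=
  ⨆ x : M, g.chartVolume (chartAt (EuclideanSpace ℝ (Fin n)) x)

theorem exists_riesz (g : SmoothMetric n M) (x : M) (l : TangentSpace (𝓡 n) x →L[ℝ] ℝ) :
    ∃ v : TangentSpace (𝓡 n) x, ∀ w, g.inner x v w = l w := by
  have : FiniteDimensional ℝ (TangentSpace (𝓡 n) x) :=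
    inferInstanceAs (FiniteDimensional ℝ (EuclideanSpace ℝ (Fin n)))
  let T : TangentSpace (𝓡 n) x →ₗ[ℝ] Module.Dual ℝ (TangentSpace (𝓡 n) x) :=
    { toFun := fun v => (g.inner x v).toLinearMap
      map_add' := fun v w => by ext; simp
      map_smul' := fun c v => by ext; simp }
  have hinj : Function.Injective T := by
    rw [← LinearMap.ker_eq_bot, LinearMap.ker_eq_bot']
    intro v hv
    by_contra hne
    have h1 := g.pos x v hne
    have h2 : T v v = 0 := by rw [hv]; rfl
    exact absurd h2 (ne_of_gt h1)
  obtain ⟨v, hv⟩ := (LinearMap.injective_iff_surjective_of_finrank_eq_finrank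
    Subspace.dual_finrank_eq.symm).1 hinj l.toLinearMap
  exact ⟨v, fun w => congrArg (fun k : Module.Dual ℝ (TangentSpace (𝓡 n) x) => k w) hv⟩

/-- The Riemannian gradient `∇f` of a differentiable function: `⟨∇f, w⟩ = df(w)`. -/
def grad (g : SmoothMetric n M) (f : M → ℝ) (x : M) : TangentSpace (𝓡 n) x :=
  Classical.choose (g.exists_riesz x (mfderiv (𝓡 n) 𝓘(ℝ, ℝ) f x))

theorem inner_grad (g : SmoothMetric n M) (f : M → ℝ) (x : M) (w : TangentSpace (𝓡 n) x) :
    g.inner x (g.grad f x) w = mfderiv (𝓡 n) 𝓘(ℝ, ℝ) f x w :=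
  Classical.choose_spec (g.exists_riesz x (mfderiv (𝓡 n) 𝓘(ℝ, ℝ) f x)) w

/-- `f` is in `W^{1,1}_loc(U)`, for an open set `U`, and its gradient in the sense of
distributions on `U` is the vector field `X`: in each chart, `f` and the components `⟨X, ∂_v⟩`
are locally integrable, and `⟨X, ∂_v⟩` is the weak derivative of `f` in the direction `v`. -/
def IsWeakGradOn (g : SmoothMetric n M) (U : Set M) (f : M → ℝ)
    (X : (x : M) → TangentSpace (𝓡 n) x) : Prop :=
  ∀ c : M, let e := chartAt (EuclideanSpace ℝ (Fin n)) c
    let W : Set (EuclideanSpace ℝ (Fin n)) := e.target ∩ e.symm ⁻¹' U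
    LocallyIntegrableOn (fun z => f (e.symm z)) W ∧
    ∀ v : EuclideanSpace ℝ (Fin n),
      LocallyIntegrableOn
        (fun z => g.inner (e.symm z) (X (e.symm z)) (chartVector e z v)) W ∧
      ∀ ψ : EuclideanSpace ℝ (Fin n) → ℝ,
        ContDiff ℝ ∞ ψ → HasCompactSupport ψ → tsupport ψ ⊆ W →
        ∫ z, f (e.symm z) * fderiv ℝ ψ z v =
          -∫ z, g.inner (e.symm z) (X (e.symm z)) (chartVector e z v) * ψ z

/-- The test functions on an open set `U`: the class `C_0^∞(U)`, extended by zero to `M`. -/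
def IsTestFunctionOn (U : Set M) (ψ : M → ℝ) : Prop :=
  ContMDiff (𝓡 n) 𝓘(ℝ, ℝ) ∞ ψ ∧ HasCompactSupport ψ ∧ tsupport ψ ⊆ U

/-- The affine gradient `∇^D f = V^{μ-λ} ∇f` with `V = e^u`, written as an operation on the
(classical or weak) gradient field `X = ∇f`. -/
def affineGrad (u : M → ℝ) (lam mu : ℝ) (X : (x : M) → TangentSpace (𝓡 n) x) (x : M) :
    TangentSpace (𝓡 n) x :=
  (Real.exp (u x) ^ (mu - lam)) • X x

/-- The affine Laplacian `Δ^D f = V^{μ-λ} (Δf + (2μ+nλ) ⟨∇u, ∇f⟩)`, `V = e^u`, as a distribution: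
its value at the test function `ψ`, when `X` is the weak gradient of `f`.  The distribution `Δf`
is `χ ↦ -∫ ⟨∇f, ∇χ⟩ dv_g`, evaluated at `χ = V^{μ-λ} ψ`. -/
def affineLaplacian [MeasurableSpace M] (g : SmoothMetric n M) (u : M → ℝ) (lam mu : ℝ)
    (X : (x : M) → TangentSpace (𝓡 n) x) (ψ : M → ℝ) : ℝ :=
  -(∫ x, g.inner x (X x) (g.grad (fun y => Real.exp (u y) ^ (mu - lam) * ψ y) x) ∂g.vol) +
    (2 * mu + n * lam) *
      ∫ x, Real.exp (u x) ^ (mu - lam) * g.inner x (g.grad u x) (X x) * ψ x ∂g.vol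

end SmoothMetric

end

/-! Put θ = V^{2(μ-λ)} and σ = V^{τ+λ-μ} = V^{(n+2)λ}, so that θσ = V^{2μ+nλ}. Against a suitable
exponential weight the affine Laplacian is a divergence (`affineLaplacian_exp_mul`), and the
hypotheses on ρ become θ|∇ρ|² = 1 and div(θσ∇ρ) ≥ Cσ/ρ weakly on Ω.

Testing this with aρ^{α+1}w, for a test function w ≥ 0, the derivative of ρ^{α+1} contributes α+1 by
the eikonal equation, and `integral_le_of_laplacian_lower_bound` results: (C+α+1)∫aρ^α σw +
∫ρ^{α+1}θ⟨∇ρ,∇a⟩σw ≤ -∫aρ^{α+1}σθ⟨∇ρ,∇w⟩. In `hardy_inequality`, w runs through smooth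
approximations of |φ|^p. The right side is then at most p∫aρ^{α+1}σ|φ|^{p-1}|θ⟨∇ρ,∇φ⟩| in the limit.
Young's inequality `mul_rpow_sub_one_mul_le` with parameter k = (C+α+1)/p splits this into
(p-1)k∫aρ^α|φ|^pσ, which is absorbed on the left, and k^{1-p} times the wanted integral.
Multiplication by k^{p-1} finishes.

The delicate point is that a is only W^{1,1}_loc, so aρ^{α+1}w is not an admissible test function.
In a chart, a and ρ are mollified (`integral_le_of_forall_test_of_weakDeriv`). The mollified a and
its derivatives converge merely in L¹, but every factor beside them stays bounded and converges
almost everywhere, because ρ is locally bounded away from 0 and |∇ρ| = V^{λ-μ} is locally bounded. A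
partition of unity removes the restriction to a chart (`integral_le_of_forall_test`). -/

noncomputable section

open Filter Topology Set

/-! ### Convergence of integrals of products. -/

section L1Convergence

variable {α : Type*} [MeasurableSpace α] {μ : Measure α}

/-- Scheffé's lemma. -/
theorem tendsto_integral_abs_sub_of_nonneg {f : ℕ → α → ℝ} {g : α → ℝ}
    (hf : ∀ k, Integrable (f k) μ) (hg : Integrable g μ) (hf0 : ∀ k x, 0 ≤ f k x)
    (hg0 : ∀ x, 0 ≤ g x) (hlim : ∀ᵐ x ∂μ, Tendsto (fun k => f k x) atTop (𝓝 (g x)))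
    (hint : ∀ k, ∫ x, f k x ∂μ = ∫ x, g x ∂μ) :
    Tendsto (fun k => ∫ x, |f k x - g x| ∂μ) atTop (𝓝 0) := by
  -- The positive part of g - f_k is dominated by g since f_k ≥ 0. The integral of |f_k - g| is
  -- twice that of this positive part, because g - f_k has integral zero.
  have h1 : Tendsto (fun k => ∫ x, max (g x - f k x) 0 ∂μ) atTop (𝓝 (∫ _, (0 : ℝ) ∂μ)) := by
    refine tendsto_integral_of_dominated_convergence g ?_ hg ?_ ?_
    · exact fun k => ((hg.sub (hf k)).pos_part).aestronglyMeasurable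
    · refine fun k => Eventually.of_forall fun x => ?_
      rw [Real.norm_of_nonneg (le_max_right _ _)]
      exact max_le (by linarith [hf0 k x]) (hg0 x)
    · filter_upwards [hlim] with x hx
      have : Tendsto (fun k => max (g x - f k x) 0) atTop (𝓝 (max (g x - g x) 0)) :=
        (tendsto_const_nhds.sub hx).max tendsto_const_nhds
      simpa using this
  have h2 : ∀ k, ∫ x, |f k x - g x| ∂μ = 2 * ∫ x, max (g x - f k x) 0 ∂μ := by
    intro k
    have e : ∀ x, |f k x - g x| = 2 * max (g x - f k x) 0 - (g x - f k x) := by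
      intro x
      rcases le_total (f k x) (g x) with h | h
      · rw [abs_of_nonpos (by linarith), max_eq_left (by linarith)]; ring
      · rw [abs_of_nonneg (by linarith), max_eq_right (by linarith)]; ring
    simp_rw [e]
    have i1 : Integrable (fun x => g x - f k x) μ := hg.sub (hf k)
    have i2 : Integrable (fun x => 2 * max (g x - f k x) 0) μ := i1.pos_part.const_mul 2
    rw [integral_sub i2 i1, integral_const_mul, integral_sub hg (hf k), hint k]
    simp
  simp_rw [h2]
  simpa using h1.const_mul 2

/-- The integral of a product converges if one factor converges in `L¹` and the other one is
bounded and converges almost everywhere. -/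
theorem tendsto_integral_mul_of_tendsto_L1_of_bounded {F G : ℕ → α → ℝ} {f g : α → ℝ} {B : ℝ}
    (hF : ∀ k, Integrable (F k) μ) (hf : Integrable f μ)
    (hFf : Tendsto (fun k => ∫ x, |F k x - f x| ∂μ) atTop (𝓝 0))
    (hG : ∀ k, AEStronglyMeasurable (G k) μ) (hGB : ∀ k, ∀ᵐ x ∂μ, |G k x| ≤ B)
    (hGg : ∀ᵐ x ∂μ, Tendsto (fun k => G k x) atTop (𝓝 (g x))) :
    (∀ k, Integrable (fun x => F k x * G k x) μ) ∧ Integrable (fun x => f x * g x) μ ∧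
      Tendsto (fun k => ∫ x, F k x * G k x ∂μ) atTop (𝓝 (∫ x, f x * g x ∂μ)) := by
  refine ⟨fun k => by simpa [mul_comm] using (hF k).bdd_mul (hG k) (hGB k), ?_, ?_⟩
  · have hgB : ∀ᵐ x ∂μ, ‖g x‖ ≤ B := by
      filter_upwards [hGg, ae_all_iff.2 hGB] with x hx hxB
      exact le_of_tendsto' hx.abs hxB
    simpa [mul_comm] using hf.bdd_mul (aestronglyMeasurable_of_tendsto_ae atTop hG hGg) hgB
  -- Split F_k G_k = f G_k + (F_k - f) G_k: dominated convergence handles the first term, the L¹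
  -- convergence and the bound B the second.
  have h1 : Tendsto (fun k => ∫ x, f x * G k x ∂μ) atTop (𝓝 (∫ x, f x * g x ∂μ)) := by
    refine tendsto_integral_of_dominated_convergence (fun x => B * |f x|) ?_
      (hf.abs.const_mul B) ?_ ?_
    · exact fun k => hf.aestronglyMeasurable.mul (hG k)
    · intro k
      filter_upwards [hGB k] with x hx
      rw [Real.norm_eq_abs, abs_mul, mul_comm]
      exact mul_le_mul_of_nonneg_right hx (abs_nonneg _)
    · filter_upwards [hGg] with x hx using hx.const_mul _
  have h2 : Tendsto (fun k => ∫ x, (F k x - f x) * G k x ∂μ) atTop (𝓝 0) := by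
    refine squeeze_zero_norm (a := fun k => B * ∫ x, |F k x - f x| ∂μ) (fun k => ?_)
      (by simpa using hFf.const_mul B)
    rw [← integral_const_mul]
    refine norm_integral_le_of_norm_le ((((hF k).sub hf).abs).const_mul B) ?_
    filter_upwards [hGB k] with x hx
    rw [Real.norm_eq_abs, abs_mul, mul_comm]
    exact mul_le_mul_of_nonneg_right hx (abs_nonneg _)
  have h3 := h1.add h2
  rw [add_zero] at h3
  refine h3.congr fun k => ?_
  have i1 : Integrable (fun x => f x * G k x) μ := by
    simpa [mul_comm] using hf.bdd_mul (hG k) (hGB k)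
  have i2 : Integrable (fun x => (F k x - f x) * G k x) μ := by
    simpa [mul_comm] using ((hF k).sub hf).bdd_mul (hG k) (hGB k)
  rw [← integral_add i1 i2]
  exact integral_congr_ae (Eventually.of_forall fun x => by simp; ring)

theorem integral_sum_add_add {ι : Type*} (s : Finset ι) {f g h : ι → α → ℝ}
    (hf : ∀ i, Integrable (f i) μ) (hg : ∀ i, Integrable (g i) μ) (hh : ∀ i, Integrable (h i) μ) :
    ∫ x, ∑ i ∈ s, (f i x + g i x + h i x) ∂μ =
      ∑ i ∈ s, ((∫ x, f i x ∂μ) + (∫ x, g i x ∂μ) + ∫ x, h i x ∂μ) := by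
  have hfg : ∀ i, Integrable (fun x => f i x + g i x) μ := fun i => (hf i).add (hg i)
  have hfgh : ∀ i, Integrable (fun x => f i x + g i x + h i x) μ := fun i => (hfg i).add (hh i)
  rw [integral_finsetSum _ fun i _ => hfgh i]
  refine Finset.sum_congr rfl fun i _ => ?_
  rw [integral_add (hfg i) (hh i), integral_add (hf i) (hg i)]

end L1Convergence

/-- Bump functions whose supports shrink to the origin, inside the ball of radius `δ`. -/
theorem exists_shrinking_bumps {E : Type*} [NormedAddCommGroup E] {δ : ℝ} (hδ : 0 < δ) :
    ∃ b : ℕ → ContDiffBump (0 : E), Tendsto (fun k => (b k).rOut) atTop (𝓝 0) ∧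
      (∀ k, (b k).rOut ≤ 2 * (b k).rIn) ∧ ∀ k, (b k).rOut ≤ δ := by
  -- The fixed ratio 2 of outer to inner radius is what the almost everywhere convergence of
  -- mollifications needs.
  refine ⟨fun k => ⟨δ / 2 * (1 / ((k : ℝ) + 1)), δ * (1 / ((k : ℝ) + 1)), by positivity, ?_⟩,
    ?_, fun k => by dsimp only; linarith, fun k => ?_⟩
  · exact mul_lt_mul_of_pos_right (by linarith) (by positivity)
  · simpa using tendsto_one_div_add_atTop_nhds_zero_nat.const_mul δ
  · have : 1 / ((k : ℝ) + 1) ≤ 1 := by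
      rw [div_le_one (by positivity)]; linarith [(Nat.cast_nonneg k : (0 : ℝ) ≤ k)]
    dsimp only
    nlinarith

/-! ### Mollification and weak derivatives in Euclidean space. -/

section Mollifier

variable {E : Type*} [NormedAddCommGroup E] [InnerProductSpace ℝ E] [FiniteDimensional ℝ E]
  [MeasurableSpace E] [BorelSpace E]

open scoped Convolution
open ContinuousLinearMap

/-- The mollification of `f` with the bump function `b`. -/
noncomputable def mollify (b : ContDiffBump (0 : E)) (f : E → ℝ) : E → ℝ :=
  b.normed volume ⋆[lsmul ℝ ℝ, volume] f

theorem mollify_apply (b : ContDiffBump (0 : E)) (f : E → ℝ) (z : E) :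
    mollify b f z = ∫ t, b.normed volume (z - t) * f t := by
  simp [mollify, convolution_eq_swap]

theorem contDiff_mollify (b : ContDiffBump (0 : E)) {f : E → ℝ} (hf : Integrable f) :
    ContDiff ℝ ∞ (mollify b f) :=
  b.hasCompactSupport_normed.contDiff_convolution_left _ b.contDiff_normed hf.locallyIntegrable

theorem integrable_normed (b : ContDiffBump (0 : E)) :
    Integrable (b.normed (volume : Measure E)) :=
  b.continuous_normed.integrable_of_hasCompactSupport b.hasCompactSupport_normed

theorem integrable_mollify (b : ContDiffBump (0 : E)) {f : E → ℝ} (hf : Integrable f) :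
    Integrable (mollify b f) :=
  (integrable_normed b).integrable_convolution _ hf

theorem integral_mollify (b : ContDiffBump (0 : E)) {f : E → ℝ} (hf : Integrable f) :
    ∫ z, mollify b f z = ∫ z, f z := by
  rw [mollify, integral_convolution _ (integrable_normed b) hf, b.integral_normed]
  simp

theorem integrable_mollify_integrand (b : ContDiffBump (0 : E)) {f : E → ℝ} (hf : Integrable f)
    (z : E) : Integrable fun t => b.normed volume (z - t) * f t := by
  obtain ⟨B, hB⟩ := b.hasCompactSupport_normed.exists_bound_of_continuous
    (b.continuous_normed (μ := (volume : Measure E)))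
  exact hf.bdd_mul (b.continuous_normed.comp (continuous_const.sub continuous_id)).aestronglyMeasurable
    (Eventually.of_forall fun t => hB _)

theorem mollify_sub (b : ContDiffBump (0 : E)) {f g : E → ℝ} (hf : Integrable f)
    (hg : Integrable g) (z : E) :
    mollify b (fun t => f t - g t) z = mollify b f z - mollify b g z := by
  simp only [mollify_apply, mul_sub]
  exact integral_sub (integrable_mollify_integrand b hf z) (integrable_mollify_integrand b hg z)

theorem mollify_nonneg (b : ContDiffBump (0 : E)) {f : E → ℝ} (hf : ∀ t, 0 ≤ f t) (z : E) :
    0 ≤ mollify b f z := by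
  rw [mollify_apply]
  exact integral_nonneg fun t => mul_nonneg (b.nonneg_normed _) (hf t)

theorem normed_sub_eq_zero (b : ContDiffBump (0 : E)) {z t : E} (h : t ∉ Metric.ball z b.rOut) :
    b.normed volume (z - t) = 0 := by
  have : z - t ∉ Function.support (b.normed (volume : Measure E)) := by
    rw [b.support_normed_eq]
    simpa [dist_eq_norm, norm_sub_rev] using h
  simpa using this

theorem integral_normed_sub (b : ContDiffBump (0 : E)) (z : E) :
    ∫ t, b.normed (volume : Measure E) (z - t) = 1 := by
  rw [integral_sub_left_eq_self (fun t => b.normed (volume : Measure E) t) volume z,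
    b.integral_normed]

theorem integrable_normed_sub (b : ContDiffBump (0 : E)) (z : E) :
    Integrable fun t => b.normed (volume : Measure E) (z - t) :=
  (integrable_normed b).comp_sub_left z

/-- The kernel is a probability density carried by the ball, so only the values of `f` there matter.
This later keeps the mollified ρ away from zero. -/
theorem le_mollify (b : ContDiffBump (0 : E)) {f : E → ℝ} (hf : Integrable f) {z : E} {m : ℝ}
    (h : ∀ᵐ t, t ∈ Metric.ball z b.rOut → m ≤ f t) : m ≤ mollify b f z := by
  rw [mollify_apply]
  calc m = ∫ t, b.normed volume (z - t) * m := by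
        rw [integral_mul_const, integral_normed_sub, one_mul]
    _ ≤ _ := by
        refine integral_mono_ae ((integrable_normed_sub b z).mul_const m)
          (integrable_mollify_integrand b hf z) ?_
        filter_upwards [h] with t ht
        by_cases hz : t ∈ Metric.ball z b.rOut
        · exact mul_le_mul_of_nonneg_left (ht hz) (b.nonneg_normed _)
        · simp [normed_sub_eq_zero b hz]

theorem mollify_le (b : ContDiffBump (0 : E)) {f : E → ℝ} (hf : Integrable f) {z : E} {m : ℝ}
    (h : ∀ᵐ t, t ∈ Metric.ball z b.rOut → f t ≤ m) : mollify b f z ≤ m := by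
  rw [mollify_apply]
  calc _ ≤ ∫ t, b.normed volume (z - t) * m := by
        refine integral_mono_ae (integrable_mollify_integrand b hf z)
          ((integrable_normed_sub b z).mul_const m) ?_
        filter_upwards [h] with t ht
        by_cases hz : t ∈ Metric.ball z b.rOut
        · exact mul_le_mul_of_nonneg_left (ht hz) (b.nonneg_normed _)
        · simp [normed_sub_eq_zero b hz]
    _ = m := by rw [integral_mul_const, integral_normed_sub, one_mul]

/-- Mollification keeps positivity and total mass and converges almost everywhere, so Scheffé's
lemma applies to the positive and the negative part separately. -/
theorem tendsto_integral_abs_mollify_sub {b : ℕ → ContDiffBump (0 : E)}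
    (hb : Tendsto (fun k => (b k).rOut) atTop (𝓝 0)) (hb2 : ∀ k, (b k).rOut ≤ 2 * (b k).rIn)
    {f : E → ℝ} (hf : Integrable f) :
    Tendsto (fun k => ∫ z, |mollify (b k) f z - f z|) atTop (𝓝 0) := by
  have key : ∀ g : E → ℝ, Integrable g → (∀ x, 0 ≤ g x) →
      Tendsto (fun k => ∫ z, |mollify (b k) g z - g z|) atTop (𝓝 0) := fun g hg hg0 =>
    tendsto_integral_abs_sub_of_nonneg (fun k => integrable_mollify _ hg) hg
      (fun k => mollify_nonneg _ hg0) hg0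
      (ContDiffBump.ae_convolution_tendsto_right_of_locallyIntegrable hb
        (Eventually.of_forall hb2) hg.locallyIntegrable)
      (fun k => integral_mollify _ hg)
  have i1 := hf.pos_part
  have i2 := hf.neg_part
  have h := (key _ i1 fun x => le_max_right _ _).add (key _ i2 fun x => le_max_right _ _)
  rw [add_zero] at h
  refine squeeze_zero (fun k => integral_nonneg fun z => abs_nonneg _) (fun k => ?_) h
  have j1 : Integrable fun z => |mollify (b k) (fun a => max (f a) 0) z - max (f z) 0| :=
    ((integrable_mollify (b k) i1).sub i1).abs
  have j2 : Integrable fun z => |mollify (b k) (fun a => max (-f a) 0) z - max (-f z) 0| :=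
    ((integrable_mollify (b k) i2).sub i2).abs
  rw [← integral_add j1 j2]
  refine integral_mono ((integrable_mollify _ hf).sub hf).abs (j1.add j2) fun z => ?_
  have e : f = fun t => max (f t) 0 - max (-f t) 0 := by
    ext t
    rcases le_total (f t) 0 with h | h
    · rw [max_eq_right h, max_eq_left (by linarith)]; ring
    · rw [max_eq_left h, max_eq_right (by linarith)]; ring
  have e1 : mollify (b k) f z =
      mollify (b k) (fun t => max (f t) 0) z - mollify (b k) (fun t => max (-f t) 0) z := by
    rw [← mollify_sub _ i1 i2]
    exact congrArg (fun g => mollify (b k) g z) e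
  have e2 : f z = max (f z) 0 - max (-f z) 0 := congrFun e z
  have e3 : mollify (b k) f z - f z =
      (mollify (b k) (fun t => max (f t) 0) z - max (f z) 0) -
        (mollify (b k) (fun t => max (-f t) 0) z - max (-f z) 0) := by
    rw [e1]; linarith [e2]
  rw [e3]
  exact abs_sub _ _

/-- `fv` is the weak derivative of `f` in the direction `v` on `W`. -/
def IsWeakDirDerivOn (W : Set E) (f : E → ℝ) (v : E) (fv : E → ℝ) : Prop :=
  ∀ ψ : E → ℝ, ContDiff ℝ ∞ ψ → HasCompactSupport ψ → tsupport ψ ⊆ W →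
    ∫ z, f z * fderiv ℝ ψ z v = -∫ z, fv z * ψ z

/-- The derivative falls on the kernel t ↦ b(z - t), a legitimate test function because its support
lies in `K`. The sign from z - t cancels the sign in the weak derivative. The cutoff to `K` makes
`f` globally integrable and is invisible near z. -/
theorem fderiv_mollify {W K : Set E} {f fv : E → ℝ} {v : E}
    (hw : IsWeakDirDerivOn W f v fv) (hfi : Integrable (K.indicator f))
    (b : ContDiffBump (0 : E)) {z : E} (hK : Metric.closedBall z b.rOut ⊆ K) (hKW : K ⊆ W) :
    fderiv ℝ (mollify b (K.indicator f)) z v = mollify b (K.indicator fv) z := by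
  have hb := b.contDiff_normed (μ := (volume : Measure E)) (n := 1)
  have hb' := b.contDiff_normed (μ := (volume : Measure E)) (n := ⊤)
  have hsub : ∀ t, HasFDerivAt (fun t => b.normed (volume : Measure E) (z - t))
      (-(fderiv ℝ (b.normed (volume : Measure E)) (z - t))) t := by
    intro t
    have h1 : HasFDerivAt (fun t : E => z - t) (-(ContinuousLinearMap.id ℝ E)) t := by
      simpa using (hasFDerivAt_id t).const_sub z
    have h2 := (((hb.differentiable one_ne_zero) (z - t)).hasFDerivAt).comp t h1
    rw [ContinuousLinearMap.comp_neg, ContinuousLinearMap.comp_id] at h2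
    exact h2
  have hsupp : Function.support (fun t => b.normed (volume : Measure E) (z - t)) ⊆
      Metric.closedBall z b.rOut := by
    intro t ht
    by_contra hn
    exact ht (normed_sub_eq_zero b fun h => hn (Metric.ball_subset_closedBall h))
  have hts : tsupport (fun t => b.normed (volume : Measure E) (z - t)) ⊆
      Metric.closedBall z b.rOut := closure_minimal hsupp Metric.isClosed_closedBall
  have hw' := hw (fun t => b.normed (volume : Measure E) (z - t))
    (hb'.comp (contDiff_const.sub contDiff_id))
    ((isCompact_closedBall z b.rOut).of_isClosed_subset (isClosed_tsupport _) hts)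
    ((hts.trans hK).trans hKW)
  have hd : fderiv ℝ (mollify b (K.indicator f)) z v =
      ∫ t, fderiv ℝ (b.normed (volume : Measure E)) (z - t) v * K.indicator f t := by
    have h := b.hasCompactSupport_normed.hasFDerivAt_convolution_left (lsmul ℝ ℝ) hb
      hfi.locallyIntegrable z
    rw [mollify, h.fderiv, convolution_eq_swap, ContinuousLinearMap.integral_apply]
    · simp [precompL_apply]
    · exact (((b.hasCompactSupport_normed.fderiv ℝ).convolutionExists_left _
        (hb.continuous_fderiv one_ne_zero) hfi.locallyIntegrable) z).integrable_swap
  rw [hd, mollify_apply]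
  calc _ = ∫ t, -(f t * fderiv ℝ (fun t => b.normed (volume : Measure E) (z - t)) t v) := by
        refine integral_congr_ae (Eventually.of_forall fun t => ?_)
        simp only [(hsub t).fderiv, _root_.neg_apply]
        by_cases ht : t ∈ K
        · simp [ht]; ring
        · have : t ∉ tsupport (fun t => b.normed (volume : Measure E) (z - t)) :=
            fun h => ht (hK (hts h))
          have h0 := (hsub t).fderiv
          rw [fderiv_of_notMem_tsupport (𝕜 := ℝ) this] at h0
          have h1 : fderiv ℝ (b.normed (volume : Measure E)) (z - t) v = 0 := by
            have := congrArg (fun l : E →L[ℝ] ℝ => l v) h0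
            simpa using this.symm
          simp [ht, h1]
    _ = ∫ t, fv t * b.normed (volume : Measure E) (z - t) := by
        rw [integral_neg, hw', neg_neg]
    _ = _ := by
        refine integral_congr_ae (Eventually.of_forall fun t => ?_)
        by_cases ht : t ∈ K
        · simp [ht]; ring
        · have : t ∉ Metric.ball z b.rOut := fun h => ht (hK (Metric.ball_subset_closedBall h))
          simp [normed_sub_eq_zero b this]

end Mollifier

/-! ### Testing a distributional inequality with weakly differentiable functions. -/

section EuclideanInequality

variable {E : Type*} [NormedAddCommGroup E] [InnerProductSpace ℝ E] [FiniteDimensional ℝ E]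
  [MeasurableSpace E] [BorelSpace E]

/-- `f` is essentially bounded on the compact subsets of `W`. -/
def IsLocallyEssBoundedOn (f : E → ℝ) (W : Set E) : Prop :=
  ∀ K ⊆ W, IsCompact K → ∃ B, ∀ᵐ z ∂volume.restrict K, |f z| ≤ B

theorem ae_abs_mollify_le {K : Set E} (hKm : MeasurableSet K) {f : E → ℝ}
    (hf : Integrable (K.indicator f)) {B : ℝ} (hB : ∀ᵐ z ∂volume.restrict K, |f z| ≤ B)
    (b : ContDiffBump (0 : E)) {z : E} (hz : Metric.closedBall z b.rOut ⊆ K) :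
    |mollify b (K.indicator f) z| ≤ B := by
  rw [ae_restrict_iff' hKm] at hB
  rw [abs_le]
  constructor
  · refine le_mollify b hf ?_
    filter_upwards [hB] with t ht h
    have hK := hz (Metric.ball_subset_closedBall h)
    rw [indicator_of_mem hK]
    exact (abs_le.1 (ht hK)).1
  · refine mollify_le b hf ?_
    filter_upwards [hB] with t ht h
    have hK := hz (Metric.ball_subset_closedBall h)
    rw [indicator_of_mem hK]
    exact (abs_le.1 (ht hK)).2

theorem tendsto_setIntegral_abs_mollify_sub {K K' : Set E} (hKK : K ⊆ K') (hK : MeasurableSet K)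
    {b : ℕ → ContDiffBump (0 : E)} (hb : Tendsto (fun k => (b k).rOut) atTop (𝓝 0))
    (hb2 : ∀ k, (b k).rOut ≤ 2 * (b k).rIn) {f : E → ℝ} (hf : Integrable (K'.indicator f)) :
    Tendsto (fun k => ∫ z in K, |mollify (b k) (K'.indicator f) z - f z|) atTop (𝓝 0) := by
  refine squeeze_zero (fun k => integral_nonneg fun z => abs_nonneg _) (fun k => ?_)
    (tendsto_integral_abs_mollify_sub hb hb2 hf)
  rw [setIntegral_congr_fun hK
    (g := fun z => |mollify (b k) (K'.indicator f) z - K'.indicator f z|)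
    fun z hz => by simp [hKK hz]]
  exact setIntegral_le_integral ((integrable_mollify _ hf).sub hf).abs
    (Eventually.of_forall fun z => abs_nonneg _)

theorem ae_restrict_tendsto_mollify {K K' : Set E} (hKK : K ⊆ K') (hK : MeasurableSet K)
    {b : ℕ → ContDiffBump (0 : E)} (hb : Tendsto (fun k => (b k).rOut) atTop (𝓝 0))
    (hb2 : ∀ k, (b k).rOut ≤ 2 * (b k).rIn) {f : E → ℝ} (hf : Integrable (K'.indicator f)) :
    ∀ᵐ z ∂volume.restrict K,
      Tendsto (fun k => mollify (b k) (K'.indicator f) z) atTop (𝓝 (f z)) := by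
  rw [ae_restrict_iff' hK]
  filter_upwards [ContDiffBump.ae_convolution_tendsto_right_of_locallyIntegrable hb
    (Eventually.of_forall hb2) hf.locallyIntegrable] with z hz hzK
  rw [indicator_of_mem (hKK hzK)] at hz
  exact hz

/-- A distributional inequality `m ≤ -div Z`, with a locally bounded vector field `Z`, can be
tested with `a ρ ^ β w`, where `a` is a weakly differentiable function, `ρ` is a positive locally
Lipschitz function and `w` is a test function. -/
theorem integral_le_of_forall_test_of_weakDeriv {ι : Type*} [Fintype ι] (v : ι → E)
    {W : Set E} (hW : IsOpen W) {m : E → ℝ} (hm : ContinuousOn m W) {Z : ι → E → ℝ}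
    (hZm : ∀ j, AEStronglyMeasurable (Z j) (volume.restrict W))
    (hZb : ∀ j, IsLocallyEssBoundedOn (Z j) W)
    (htest : ∀ P : E → ℝ, ContDiff ℝ ∞ P → HasCompactSupport P → tsupport P ⊆ W →
      (∀ z, 0 ≤ P z) → ∫ z, m z * P z ≤ ∫ z, ∑ j, Z j z * fderiv ℝ P z (v j))
    {a ρ : E → ℝ} (ha0 : ∀ z, 0 ≤ a z) (ha : LocallyIntegrableOn a W)
    (hρ : ContinuousOn ρ W) (hρ0 : ∀ z ∈ W, 0 < ρ z) {A ξ : ι → E → ℝ}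
    (hA : ∀ j, LocallyIntegrableOn (A j) W) (hξ : ∀ j, LocallyIntegrableOn (ξ j) W)
    (hAw : ∀ j, IsWeakDirDerivOn W a (v j) (A j))
    (hξw : ∀ j, IsWeakDirDerivOn W ρ (v j) (ξ j))
    (hξb : ∀ j, IsLocallyEssBoundedOn (ξ j) W) (β : ℝ)
    {w : E → ℝ} (hw : ContDiff ℝ ∞ w) (hwc : HasCompactSupport w) (hwW : tsupport w ⊆ W)
    (hw0 : ∀ z, 0 ≤ w z) :
    ∫ z, m z * (a z * ρ z ^ β * w z) ≤
      ∫ z, ∑ j, Z j z * (A j z * ρ z ^ β * w z + a z * (β * ρ z ^ (β - 1) * ξ j z) * w z +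
        a z * ρ z ^ β * fderiv ℝ w z (v j)) := by
  set K := tsupport w with hKdef
  have hKc : IsCompact K := hwc
  have hKm : MeasurableSet K := hKc.measurableSet
  -- All data are cut off to a compact neighbourhood `K'` of the support of `w` inside `W`.
  -- Mollifying at a scale at most δ then does not see the cutoff from points of `K`.
  obtain ⟨δ, hδ, hδW⟩ := hKc.exists_cthickening_subset_open hW hwW
  set K' := Metric.cthickening δ K with hK'def
  have hK'c : IsCompact K' := hKc.cthickening
  have hK'm : MeasurableSet K' := hK'c.measurableSet
  have hKK' : K ⊆ K' := Metric.self_subset_cthickening K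
  obtain ⟨b, hb, hb2, hbδ⟩ := exists_shrinking_bumps (E := E) hδ
  have hball : ∀ k, ∀ z ∈ K, Metric.closedBall z (b k).rOut ⊆ K' := fun k z hz =>
    (Metric.closedBall_subset_closedBall (hbδ k)).trans
      (Metric.closedBall_subset_cthickening hz δ)
  have hai : Integrable (K'.indicator a) :=
    (ha.integrableOn_compact_subset hδW hK'c).integrable_indicator hK'm
  have hρi : Integrable (K'.indicator ρ) :=
    ((hρ.mono hδW).integrableOn_compact hK'c).integrable_indicator hK'm
  have hAi : ∀ j, Integrable (K'.indicator (A j)) := fun j =>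
    ((hA j).integrableOn_compact_subset hδW hK'c).integrable_indicator hK'm
  have hξi : ∀ j, Integrable (K'.indicator (ξ j)) := fun j =>
    ((hξ j).integrableOn_compact_subset hδW hK'c).integrable_indicator hK'm
  have haK : IntegrableOn a K := ha.integrableOn_compact_subset hwW hKc
  have hAK : ∀ j, IntegrableOn (A j) K := fun j => (hA j).integrableOn_compact_subset hwW hKc
  have hZK : ∀ j, AEStronglyMeasurable (Z j) (volume.restrict K) := fun j =>
    (hZm j).mono_measure (Measure.restrict_mono hwW le_rfl)
  have hmK : AEStronglyMeasurable m (volume.restrict K) :=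
    (hm.mono hwW).aestronglyMeasurable hKm
  obtain ⟨Bm, hBm⟩ := hKc.exists_bound_of_continuousOn (hm.mono hwW)
  choose BZ hBZ using fun j => hZb j K hwW hKc
  choose Bξ hBξ using fun j => hξb j K' hδW hK'c
  obtain ⟨Bw, hBw⟩ := hKc.exists_bound_of_continuousOn hw.continuous.continuousOn
  have hdw : Continuous (fderiv ℝ w) := hw.continuous_fderiv (by simp)
  choose Bdw hBdw using fun j => hKc.exists_bound_of_continuousOn
    (f := fun z => fderiv ℝ w z (v j)) (hdw.clm_apply continuous_const).continuousOn
  obtain ⟨m0, hm0, hm0'⟩ := hK'c.exists_forall_le' (hρ.mono hδW)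
    (fun z hz => hρ0 z (hδW hz))
  obtain ⟨M0, hM0⟩ := hK'c.exists_bound_of_continuousOn (hρ.mono hδW)
  set ak : ℕ → E → ℝ := fun k => mollify (b k) (K'.indicator a) with hak
  set ρk : ℕ → E → ℝ := fun k => mollify (b k) (K'.indicator ρ) with hρk
  set Ak : ι → ℕ → E → ℝ := fun j k => mollify (b k) (K'.indicator (A j)) with hAk
  set ξk : ι → ℕ → E → ℝ := fun j k => mollify (b k) (K'.indicator (ξ j)) with hξk
  have hak_smooth : ∀ k, ContDiff ℝ ∞ (ak k) := fun k => contDiff_mollify _ hai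
  have hρk_smooth : ∀ k, ContDiff ℝ ∞ (ρk k) := fun k => contDiff_mollify _ hρi
  -- Averages of ρ stay between its bounds on `K'`, and m0 > 0, so powers of the mollified ρ are
  -- uniformly bounded even for negative exponents.
  have hρk_mem : ∀ k, ∀ z ∈ K, ρk k z ∈ Icc m0 M0 := by
    intro k z hz
    constructor
    · refine le_mollify _ hρi (Eventually.of_forall fun t ht => ?_)
      have := hball k z hz (Metric.ball_subset_closedBall ht)
      rw [indicator_of_mem this]; exact hm0' t this
    · refine mollify_le _ hρi (Eventually.of_forall fun t ht => ?_)
      have := hball k z hz (Metric.ball_subset_closedBall ht)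
      rw [indicator_of_mem this]; exact (le_abs_self _).trans (hM0 t this)
  have hρk_pos : ∀ k, ∀ z ∈ K, 0 < ρk k z := fun k z hz => hm0.trans_le (hρk_mem k z hz).1
  have hpow : ∀ γ : ℝ, ∃ B, 0 ≤ B ∧ ∀ k, ∀ z ∈ K, |ρk k z ^ γ| ≤ B := by
    intro γ
    have hc : ContinuousOn (fun x : ℝ => x ^ γ) (Icc m0 M0) := fun x hx =>
      (Real.continuousAt_rpow_const x γ (Or.inl (hm0.trans_le hx.1).ne')).continuousWithinAt
    obtain ⟨B, hB⟩ := isCompact_Icc.exists_bound_of_continuousOn hc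
    exact ⟨max B 0, le_max_right _ _, fun k z hz =>
      (hB _ (hρk_mem k z hz)).trans (le_max_left _ _)⟩
  have hpow_meas : ∀ (γ : ℝ) k, AEStronglyMeasurable (fun z => ρk k z ^ γ) (volume.restrict K) := by
    intro γ k
    refine ContinuousOn.aestronglyMeasurable ?_ hKm
    exact (hρk_smooth k).continuous.continuousOn.rpow_const
      fun z hz => Or.inl (hρk_pos k z hz).ne'
  have hρ_lim := ae_restrict_tendsto_mollify hKK' hKm hb hb2 hρi
  have hpow_lim : ∀ γ : ℝ, ∀ᵐ z ∂volume.restrict K,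
      Tendsto (fun k => ρk k z ^ γ) atTop (𝓝 (ρ z ^ γ)) := by
    intro γ
    filter_upwards [hρ_lim, ae_restrict_mem hKm] with z hz hzK
    exact hz.rpow_const (Or.inl (hρ0 z (hwW hzK)).ne')
  have ha_lim := tendsto_setIntegral_abs_mollify_sub hKK' hKm hb hb2 hai
  have hA_lim := fun j => tendsto_setIntegral_abs_mollify_sub hKK' hKm hb hb2 (hAi j)
  have hξ_lim := fun j => ae_restrict_tendsto_mollify hKK' hKm hb hb2 (hξi j)
  obtain ⟨B1, hB10, hB1⟩ := hpow β
  obtain ⟨B2, hB20, hB2⟩ := hpow (β - 1)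
  have hwm : AEStronglyMeasurable w (volume.restrict K) := hw.continuous.aestronglyMeasurable
  have hdwm : ∀ j, AEStronglyMeasurable (fun z => fderiv ℝ w z (v j)) (volume.restrict K) :=
    fun j => (hdw.clm_apply continuous_const).aestronglyMeasurable
  -- the mollified test function and its derivative
  set P : ℕ → E → ℝ := fun k z => ak k z * ρk k z ^ β * w z with hP
  have hPsupp : ∀ k, tsupport (P k) ⊆ K := fun k =>
    closure_mono fun z hz h => hz (by simp [hP, h])
  have hP_smooth : ∀ k, ContDiff ℝ ∞ (P k) := by
    intro k
    rw [contDiff_iff_contDiffAt]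
    intro z
    by_cases hz : z ∈ K
    · exact ((hak_smooth k).contDiffAt.mul ((hρk_smooth k).contDiffAt.rpow_const_of_ne
        (hρk_pos k z hz).ne')).mul hw.contDiffAt
    · have : P k =ᶠ[𝓝 z] fun _ => 0 := by
        filter_upwards [(isClosed_tsupport w).isOpen_compl.mem_nhds hz] with y hy
        simp [hP, image_eq_zero_of_notMem_tsupport hy]
      exact contDiffAt_const.congr_of_eventuallyEq this
  have hPnn : ∀ k z, 0 ≤ P k z := by
    intro k z
    by_cases hz : z ∈ K
    · refine mul_nonneg (mul_nonneg (mollify_nonneg _ (fun t => ?_) z)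
        (Real.rpow_nonneg (hρk_pos k z hz).le _)) (hw0 z)
      exact indicator_nonneg (fun t _ => ha0 t) t
    · simp [hP, image_eq_zero_of_notMem_tsupport hz]
  have hPd : ∀ k, ∀ z ∈ K, ∀ j, fderiv ℝ (P k) z (v j) =
      Ak j k z * ρk k z ^ β * w z + ak k z * (β * ρk k z ^ (β - 1) * ξk j k z) * w z +
        ak k z * ρk k z ^ β * fderiv ℝ w z (v j) := by
    intro k z hz j
    have d1 := ((hak_smooth k).differentiable (by simp) z).hasFDerivAt
    have d2 := ((hρk_smooth k).differentiable (by simp) z).hasFDerivAt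
    have d3 := (hw.differentiable (by simp) z).hasFDerivAt
    have d4 := d2.rpow_const (p := β) (Or.inl (hρk_pos k z hz).ne')
    have d5 := (d1.mul d4).mul d3
    have e1 : fderiv ℝ (ak k) z (v j) = Ak j k z :=
      fderiv_mollify (hAw j) hai (b k) (hball k z hz) hδW
    have e2 : fderiv ℝ (ρk k) z (v j) = ξk j k z :=
      fderiv_mollify (hξw j) hρi (b k) (hball k z hz) hδW
    have d6 : fderiv ℝ (P k) z = _ := d5.fderiv
    rw [d6]
    simp [e1, e2]
    ring
  have hakK : ∀ k, IntegrableOn (ak k) K := fun k => (integrable_mollify _ hai).integrableOn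
  have hAkK : ∀ j k, IntegrableOn (Ak j k) K := fun j k =>
    (integrable_mollify _ (hAi j)).integrableOn
  have hξkm : ∀ j k, AEStronglyMeasurable (ξk j k) (volume.restrict K) := fun j k =>
    (contDiff_mollify _ (hξi j)).continuous.aestronglyMeasurable
  have bound : ∀ (h : E → ℝ) (B : ℝ), (∀ᵐ z ∂volume.restrict K, |h z| ≤ B) → ∀ y : E → ℝ,
      ∀ B' : ℝ, 0 ≤ B' → (∀ᵐ z ∂volume.restrict K, |y z| ≤ B') →
      ∀ᵐ z ∂volume.restrict K, |h z * y z| ≤ B * B' := by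
    intro h B hB y B' hB' hyB
    filter_upwards [hB, hyB] with z h1 h2
    rw [abs_mul]
    exact mul_le_mul h1 h2 (abs_nonneg _) ((abs_nonneg _).trans h1)
  have onK : ∀ (h : E → ℝ) (B : ℝ), (∀ z ∈ K, |h z| ≤ B) →
      ∀ᵐ z ∂volume.restrict K, |h z| ≤ B := by
    intro h B hB
    filter_upwards [ae_restrict_mem hKm] with z hz using hB z hz
  have bw : ∀ᵐ z ∂volume.restrict K, |w z| ≤ max Bw 0 :=
    onK _ _ fun z hz => (hBw z hz).trans (le_max_left _ _)
  have bdw : ∀ j, ∀ᵐ z ∂volume.restrict K, |fderiv ℝ w z (v j)| ≤ max (Bdw j) 0 := fun j =>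
    onK _ _ fun z hz => (hBdw j z hz).trans (le_max_left _ _)
  -- Each term of the tested inequality is written as an L¹-convergent factor (the mollified `a` or
  -- `A j`) times a bounded factor that converges almost everywhere. Then `l1` is the left side, and
  -- `l2`, `l3`, `l4` come from the product rule.
  have l1 := tendsto_integral_mul_of_tendsto_L1_of_bounded (μ := volume.restrict K)
    (F := ak) (G := fun k z => m z * w z * ρk k z ^ β) (g := fun z => m z * w z * ρ z ^ β)
    hakK haK ha_lim (fun k => (hmK.mul hwm).mul (hpow_meas β k))
    (fun k => bound _ _ (bound _ _ (onK _ _ hBm) _ _ (le_max_right _ _) bw) _ _ hB10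
      (onK _ _ (hB1 k)))
    (by filter_upwards [hpow_lim β] with z hz using hz.const_mul _)
  have l2 := fun j => tendsto_integral_mul_of_tendsto_L1_of_bounded (μ := volume.restrict K)
    (F := Ak j) (G := fun k z => Z j z * w z * ρk k z ^ β)
    (g := fun z => Z j z * w z * ρ z ^ β)
    (hAkK j) (hAK j) (hA_lim j) (fun k => ((hZK j).mul hwm).mul (hpow_meas β k))
    (fun k => bound _ _ (bound _ _ (hBZ j) _ _ (le_max_right _ _) bw) _ _ hB10
      (onK _ _ (hB1 k)))
    (by filter_upwards [hpow_lim β] with z hz using hz.const_mul _)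
  -- Here the derivative of ρ meets `a`: the product of two sequences converging only in L¹ would be
  -- out of control, so the essential bound on `ξ j` is indispensable.
  have l3 := fun j => tendsto_integral_mul_of_tendsto_L1_of_bounded (μ := volume.restrict K)
    (F := ak) (G := fun k z => Z j z * w z * (β * ρk k z ^ (β - 1)) * ξk j k z)
    (g := fun z => Z j z * w z * (β * ρ z ^ (β - 1)) * ξ j z)
    hakK haK ha_lim
    (fun k => (((hZK j).mul hwm).mul ((hpow_meas (β - 1) k).const_mul β)).mul (hξkm j k))
    (fun k => bound _ _ (bound _ _ (bound _ _ (hBZ j) _ _ (le_max_right _ _) bw) _ (|β| * B2)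
      (by positivity) (onK _ _ fun z hz => by
        rw [abs_mul]; exact mul_le_mul_of_nonneg_left (hB2 k z hz) (abs_nonneg _))) _
      (max (Bξ j) 0) (le_max_right _ _)
      (onK _ _ fun z hz => (ae_abs_mollify_le hK'm (hξi j) (hBξ j) (b k)
        (hball k z hz)).trans (le_max_left _ _)))
    (by
      filter_upwards [hpow_lim (β - 1), hξ_lim j] with z hz hz'
        using ((hz.const_mul _).const_mul _).mul hz')
  have l4 := fun j => tendsto_integral_mul_of_tendsto_L1_of_bounded (μ := volume.restrict K)
    (F := ak) (G := fun k z => Z j z * fderiv ℝ w z (v j) * ρk k z ^ β)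
    (g := fun z => Z j z * fderiv ℝ w z (v j) * ρ z ^ β)
    hakK haK ha_lim (fun k => ((hZK j).mul (hdwm j)).mul (hpow_meas β k))
    (fun k => bound _ _ (bound _ _ (hBZ j) _ _ (le_max_right _ _) (bdw j)) _ _ hB10
      (onK _ _ (hB1 k)))
    (by filter_upwards [hpow_lim β] with z hz using hz.const_mul _)
  have hw_off : ∀ z, z ∉ K → w z = 0 := fun z hz => image_eq_zero_of_notMem_tsupport hz
  have hdw_off : ∀ z, z ∉ K → fderiv ℝ w z = 0 := fun z hz => fderiv_of_notMem_tsupport (𝕜 := ℝ) hz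
  have hineq : ∀ k, ∫ z in K, ak k z * (m z * w z * ρk k z ^ β) ≤
      ∑ j, ((∫ z in K, Ak j k z * (Z j z * w z * ρk k z ^ β)) +
        (∫ z in K, ak k z * (Z j z * w z * (β * ρk k z ^ (β - 1)) * ξk j k z)) +
        ∫ z in K, ak k z * (Z j z * fderiv ℝ w z (v j) * ρk k z ^ β)) := by
    intro k
    have h := htest (P k) (hP_smooth k) (hKc.of_isClosed_subset (isClosed_tsupport _) (hPsupp k))
      ((hPsupp k).trans hwW) (hPnn k)
    rw [← setIntegral_eq_integral_of_forall_compl_eq_zero (s := K)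
        (f := fun z => m z * P k z) (fun z hz => by simp [hP, hw_off z hz]),
      ← setIntegral_eq_integral_of_forall_compl_eq_zero (s := K)
        (f := fun z => ∑ j, Z j z * fderiv ℝ (P k) z (v j)) (fun z hz => by
          simp [fderiv_of_notMem_tsupport (𝕜 := ℝ) (fun h => hz (hPsupp k h))])] at h
    refine (le_of_eq ?_).trans (h.trans (le_of_eq ?_))
    · refine setIntegral_congr_fun hKm fun z _ => ?_
      simp only [hP]; ring
    · rw [setIntegral_congr_fun hKm (g := fun z => ∑ j,
        (Ak j k z * (Z j z * w z * ρk k z ^ β) +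
          ak k z * (Z j z * w z * (β * ρk k z ^ (β - 1)) * ξk j k z) +
          ak k z * (Z j z * fderiv ℝ w z (v j) * ρk k z ^ β)))]
      · exact integral_sum_add_add _ (fun j => (l2 j).1 k) (fun j => (l3 j).1 k)
          (fun j => (l4 j).1 k)
      · intro z hz
        refine Finset.sum_congr rfl fun j _ => ?_
        rw [hPd k z hz j]; ring
  have hfin := le_of_tendsto_of_tendsto' l1.2.2
    (tendsto_finsetSum _ fun j _ => ((l2 j).2.2.add (l3 j).2.2).add (l4 j).2.2) hineq
  rw [← setIntegral_eq_integral_of_forall_compl_eq_zero (s := K)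
      (f := fun z => m z * (a z * ρ z ^ β * w z)) (fun z hz => by simp [hw_off z hz]),
    ← setIntegral_eq_integral_of_forall_compl_eq_zero (s := K)
      (f := fun z => ∑ j, Z j z * (A j z * ρ z ^ β * w z +
        a z * (β * ρ z ^ (β - 1) * ξ j z) * w z + a z * ρ z ^ β * fderiv ℝ w z (v j)))
      (fun z hz => by simp [hw_off z hz, hdw_off z hz])]
  refine (le_of_eq ?_).trans (hfin.trans (le_of_eq ?_))
  · exact setIntegral_congr_fun hKm fun z _ => by ring
  · rw [setIntegral_congr_fun hKm (g := fun z => ∑ j,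
      (A j z * (Z j z * w z * ρ z ^ β) +
        a z * (Z j z * w z * (β * ρ z ^ (β - 1)) * ξ j z) +
        a z * (Z j z * fderiv ℝ w z (v j) * ρ z ^ β)))]
    · exact (integral_sum_add_add _ (fun j => (l2 j).2.1) (fun j => (l3 j).2.1)
        (fun j => (l4 j).2.1)).symm
    · intro z hz
      refine Finset.sum_congr rfl fun j _ => ?_
      ring

end EuclideanInequality

/-! ### The metric in the coordinates of a chart. -/

namespace SmoothMetric

variable {n : ℕ} {M : Type*} [TopologicalSpace M]
  [ChartedSpace (EuclideanSpace ℝ (Fin n)) M] [IsManifold (𝓡 n) ∞ M]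

section Chart

variable {e : OpenPartialHomeomorph M (EuclideanSpace ℝ (Fin n))}

theorem mdifferentiable_of_mem_atlas (he : e ∈ atlas (EuclideanSpace ℝ (Fin n)) M) :
    e.MDifferentiable (𝓡 n) (𝓡 n) :=
  have : IsManifold (𝓡 n) 1 M := IsManifold.of_le (n := ∞) (by simp)
  _root_.mdifferentiable_of_mem_atlas he

theorem chartVector_bijective (he : e ∈ atlas (EuclideanSpace ℝ (Fin n)) M)
    {z : EuclideanSpace ℝ (Fin n)} (hz : z ∈ e.target) :
    Function.Bijective (chartVector e z) :=
  have : IsManifold (𝓡 n) 1 M := IsManifold.of_le (n := ∞) (by simp)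
  (mdifferentiable_of_mem_atlas he).symm.mfderiv_bijective hz

theorem chartVector_eq_sum (z v : EuclideanSpace ℝ (Fin n)) :
    chartVector e z v = ∑ i, v i • chartVector e z (EuclideanSpace.single i 1) := by
  have h : v = ∑ i, v i • (EuclideanSpace.single i (1 : ℝ) : EuclideanSpace ℝ (Fin n)) := by
    simpa using ((EuclideanSpace.basisFun (Fin n) ℝ).sum_repr v).symm
  let L : EuclideanSpace ℝ (Fin n) →L[ℝ] TangentSpace (𝓡 n) (e.symm z) :=
    mfderiv (𝓡 n) (𝓡 n) e.symm z
  have hL : ∀ v, chartVector e z v = L v := fun _ => rfl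
  simp_rw [hL]
  conv_lhs => rw [h]
  simp_rw [map_sum, map_smul]

theorem mfderiv_chartVector (he : e ∈ atlas (EuclideanSpace ℝ (Fin n)) M)
    {z : EuclideanSpace ℝ (Fin n)} (hz : z ∈ e.target) {f : M → ℝ}
    (hf : MDifferentiableAt (𝓡 n) 𝓘(ℝ, ℝ) f (e.symm z)) (v : EuclideanSpace ℝ (Fin n)) :
    mfderiv (𝓡 n) 𝓘(ℝ, ℝ) f (e.symm z) (chartVector e z v) =
      fderiv ℝ (fun y => f (e.symm y)) z v := by
  have h1 : MDifferentiableAt (𝓡 n) (𝓡 n) e.symm z :=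
    (mdifferentiable_of_mem_atlas he).mdifferentiableAt_symm hz
  have h2 := mfderiv_comp z hf h1
  rw [mfderiv_eq_fderiv] at h2
  have h3 := congrArg (fun l => l v) h2
  exact h3.symm

theorem gram_mulVec_dotProduct (g : SmoothMetric n M) (z x y : EuclideanSpace ℝ (Fin n)) :
    g.inner (e.symm z) (chartVector e z x) (chartVector e z y) =
      dotProduct x.ofLp ((g.gram e z).mulVec y.ofLp) := by
  rw [chartVector_eq_sum z x, chartVector_eq_sum z y]
  simp only [map_sum, map_smul, _root_.sum_apply, _root_.smul_apply,
    smul_eq_mul, dotProduct, Matrix.mulVec, gram, Matrix.of_apply, Finset.mul_sum]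
  rw [Finset.sum_comm]
  refine Finset.sum_congr rfl fun i _ => Finset.sum_congr rfl fun j _ => ?_
  ring

theorem gram_posDef (g : SmoothMetric n M) (he : e ∈ atlas (EuclideanSpace ℝ (Fin n)) M)
    {z : EuclideanSpace ℝ (Fin n)} (hz : z ∈ e.target) : (g.gram e z).PosDef := by
  refine Matrix.PosDef.of_dotProduct_mulVec_pos ?_ fun x hx => ?_
  · ext i j
    simp [gram, Matrix.conjTranspose_apply, g.symm (e.symm z)]
  · have h := g.gram_mulVec_dotProduct (e := e) z (WithLp.toLp 2 x) (WithLp.toLp 2 x)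
    have h2 : chartVector e z (WithLp.toLp 2 x) ≠ 0 := by
      intro h0
      have h1 : chartVector e z 0 = 0 := map_zero (mfderiv (𝓡 n) (𝓡 n) e.symm z)
      have := (chartVector_bijective he hz).1 (h0.trans h1.symm)
      exact hx (by simpa using congrArg WithLp.ofLp this)
    have h3 := g.pos _ _ h2
    rw [h] at h3
    simpa using h3

/-- The inner product in terms of the covariant components of two tangent vectors. -/
theorem inner_eq_sum_inv_gram (g : SmoothMetric n M)
    (he : e ∈ atlas (EuclideanSpace ℝ (Fin n)) M)
    {z : EuclideanSpace ℝ (Fin n)} (hz : z ∈ e.target) (X Y : TangentSpace (𝓡 n) (e.symm z)) :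
    g.inner (e.symm z) X Y = ∑ j, (∑ i, g.inner (e.symm z) X
      (chartVector e z (EuclideanSpace.single i 1)) * (g.gram e z)⁻¹ i j) *
      g.inner (e.symm z) Y (chartVector e z (EuclideanSpace.single j 1)) := by
  obtain ⟨x, rfl⟩ := (chartVector_bijective he hz).2 X
  obtain ⟨y, rfl⟩ := (chartVector_bijective he hz).2 Y
  have hG := g.gram_posDef he hz
  have hGu : IsUnit (g.gram e z).det := (Matrix.isUnit_iff_isUnit_det _).1 hG.isUnit
  have hc : ∀ x : EuclideanSpace ℝ (Fin n), ∀ i, g.inner (e.symm z) (chartVector e z x)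
      (chartVector e z (EuclideanSpace.single i 1)) = Matrix.vecMul x.ofLp (g.gram e z) i := by
    intro x i
    rw [gram_mulVec_dotProduct]
    simp [Matrix.vecMul, dotProduct, Matrix.col]
  simp_rw [hc]
  have h1 : ∀ j, ∑ i, Matrix.vecMul x.ofLp (g.gram e z) i * (g.gram e z)⁻¹ i j = x j := by
    intro j
    have : Matrix.vecMul (Matrix.vecMul x.ofLp (g.gram e z)) (g.gram e z)⁻¹ = x.ofLp := by
      rw [Matrix.vecMul_vecMul, Matrix.mul_nonsing_inv _ hGu, Matrix.vecMul_one]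
    exact congrFun this j
  simp_rw [h1]
  rw [gram_mulVec_dotProduct]
  have hs : (g.gram e z).transpose = g.gram e z := by
    simpa [Matrix.IsHermitian, Matrix.conjTranspose_eq_transpose_of_trivial] using hG.1
  have : Matrix.vecMul y.ofLp (g.gram e z) = (g.gram e z).mulVec y.ofLp := by
    conv_lhs => rw [← hs]
    rw [Matrix.vecMul_transpose]
  rw [this]
  rfl

open scoped Bundle in
-- Coordinate fields are images of constant fields under the tangent map of `e.symm`, hence
-- continuous sections of the tangent bundle. The metric, viewed as a continuous Riemannian
-- structure on that bundle, pairs them continuously.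
theorem continuousOn_gram_apply (g : SmoothMetric n M)
    (he : e ∈ atlas (EuclideanSpace ℝ (Fin n)) M) (v w : EuclideanSpace ℝ (Fin n)) :
    ContinuousOn (fun z => g.inner (e.symm z) (chartVector e z v) (chartVector e z w))
      e.target := by
  have : IsManifold (𝓡 n) 1 M := IsManifold.of_le (n := ∞) (by simp)
  have hsm : ContMDiffOn (𝓡 n) (𝓡 n) 1 e.symm e.target :=
    contMDiffOn_symm_of_mem_maximalAtlas (IsManifold.subset_maximalAtlas he)
  have hsec : ∀ v : EuclideanSpace ℝ (Fin n), ContinuousOn (fun z =>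
      (⟨e.symm z, chartVector e z v⟩ : TangentBundle (𝓡 n) M)) e.target := by
    intro v
    have h1 := hsm.continuousOn_tangentMapWithin (by simp) e.open_target.uniqueMDiffOn
    have h2 : Continuous fun z : EuclideanSpace ℝ (Fin n) =>
        (⟨z, v⟩ : TangentBundle (𝓡 n) (EuclideanSpace ℝ (Fin n))) :=
      (tangentBundleModelSpaceHomeomorph (𝓡 n)).symm.continuous.comp
        (continuous_id.prodMk continuous_const)
    refine (h1.comp h2.continuousOn (fun z hz => hz)).congr fun z hz => ?_
    simp only [Function.comp, tangentMapWithin]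
    rw [mfderivWithin_of_isOpen e.open_target hz]
    rfl
  let : Bundle.RiemannianBundle (fun x : M => TangentSpace (𝓡 n) x) := ⟨g.toRiemannianMetric⟩
  have : IsContinuousRiemannianBundle (EuclideanSpace ℝ (Fin n))
      (fun x : M => TangentSpace (𝓡 n) x) :=
    ⟨⟨g.inner, g.contMDiff.continuous, fun _ _ _ => rfl⟩⟩
  exact ContinuousOn.inner_bundle (F := EuclideanSpace ℝ (Fin n))
    (E := fun x : M => TangentSpace (𝓡 n) x) (hsec v) (hsec w)

end Chart

end SmoothMetric

/-! ### Change of charts and the Riemannian volume. -/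

namespace SmoothMetric

section CoordinateMeasurability

variable {n : ℕ} {M : Type*} [TopologicalSpace M] [MeasurableSpace M] [BorelSpace M]

theorem measurableSet_symm_preimage (e : OpenPartialHomeomorph M (EuclideanSpace ℝ (Fin n)))
    {A : Set M} (hA : MeasurableSet A) : MeasurableSet (e.symm ⁻¹' A ∩ e.target) := by
  rw [inter_comm]
  have h := e.continuousOn_symm.domRestrict.measurable hA
  rw [← MeasurableEmbedding.subtype_coe e.open_target.measurableSet |>.measurableSet_image] at h
  convert h using 1
  ext z
  simp [and_comm]

theorem aemeasurable_symm (e : OpenPartialHomeomorph M (EuclideanSpace ℝ (Fin n)))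
    {f : EuclideanSpace ℝ (Fin n) → ℝ≥0∞} :
    AEMeasurable e.symm ((volume.restrict e.target).withDensity f) :=
  (e.continuousOn_symm.aemeasurable e.open_target.measurableSet).mono_ac
    (withDensity_absolutelyContinuous _ _)

theorem measurableSet_chart_preimage
    (e : OpenPartialHomeomorph M (EuclideanSpace ℝ (Fin n))) {B : Set (EuclideanSpace ℝ (Fin n))}
    (hB : MeasurableSet B) : MeasurableSet (e.source ∩ e ⁻¹' B) := by
  have h := e.continuousOn.domRestrict.measurable hB
  rw [← MeasurableEmbedding.subtype_coe e.open_source.measurableSet |>.measurableSet_image] at h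
  convert h using 1
  ext z
  simp [and_comm]

end CoordinateMeasurability

variable {n : ℕ} {M : Type*} [TopologicalSpace M]
  [ChartedSpace (EuclideanSpace ℝ (Fin n)) M] [IsManifold (𝓡 n) ∞ M]
  {e e' : OpenPartialHomeomorph M (EuclideanSpace ℝ (Fin n))}

/-- The density `√(det g_ij)` of the Riemannian volume in a chart. -/
def density (g : SmoothMetric n M) (e : OpenPartialHomeomorph M (EuclideanSpace ℝ (Fin n)))
    (z : EuclideanSpace ℝ (Fin n)) : ℝ :=
  Real.sqrt (g.gram e z).det

theorem density_pos (g : SmoothMetric n M) (he : e ∈ atlas (EuclideanSpace ℝ (Fin n)) M)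
    {z : EuclideanSpace ℝ (Fin n)} (hz : z ∈ e.target) : 0 < g.density e z :=
  Real.sqrt_pos.2 (g.gram_posDef he hz).det_pos

theorem continuousOn_gram (g : SmoothMetric n M)
    (he : e ∈ atlas (EuclideanSpace ℝ (Fin n)) M) : ContinuousOn (g.gram e) e.target :=
  continuousOn_pi.2 fun _ => continuousOn_pi.2 fun _ => g.continuousOn_gram_apply he _ _

theorem continuousOn_det_gram (g : SmoothMetric n M)
    (he : e ∈ atlas (EuclideanSpace ℝ (Fin n)) M) :
    ContinuousOn (fun z => (g.gram e z).det) e.target :=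
  (continuous_id.matrix_det).comp_continuousOn (g.continuousOn_gram he)

theorem continuousOn_density (g : SmoothMetric n M)
    (he : e ∈ atlas (EuclideanSpace ℝ (Fin n)) M) : ContinuousOn (g.density e) e.target :=
  (g.continuousOn_det_gram he).sqrt

theorem continuousOn_inv_gram_apply (g : SmoothMetric n M)
    (he : e ∈ atlas (EuclideanSpace ℝ (Fin n)) M) (i j : Fin n) :
    ContinuousOn (fun z => (g.gram e z)⁻¹ i j) e.target := by
  have h : ∀ z ∈ e.target, (g.gram e z)⁻¹ i j =
      (g.gram e z).det⁻¹ * (g.gram e z).adjugate i j := by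
    intro z _
    rw [Matrix.inv_def, Ring.inverse_eq_inv']
    rfl
  refine ContinuousOn.congr ?_ h
  refine ((g.continuousOn_det_gram he).inv₀ fun z hz => (g.gram_posDef he hz).det_pos.ne').mul ?_
  have h2 : ContinuousOn (fun z => (g.gram e z).adjugate) e.target :=
    (continuous_id.matrix_adjugate).comp_continuousOn (g.continuousOn_gram he)
  exact continuousOn_pi.1 (continuousOn_pi.1 h2 i) j

theorem differentiableAt_transition (he : e ∈ atlas (EuclideanSpace ℝ (Fin n)) M)
    (he' : e' ∈ atlas (EuclideanSpace ℝ (Fin n)) M) {z : EuclideanSpace ℝ (Fin n)}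
    (hz : z ∈ e.target) (hz' : e.symm z ∈ e'.source) :
    DifferentiableAt ℝ (fun y => e' (e.symm y)) z := by
  have h1 := (mdifferentiable_of_mem_atlas he).mdifferentiableAt_symm hz
  have h2 := (mdifferentiable_of_mem_atlas he').mdifferentiableAt hz'
  exact mdifferentiableAt_iff_differentiableAt.1 (h2.comp z h1)

/-- The chain rule for `e.symm` = `e'.symm` ∘ (`e'` ∘ `e.symm`), valid near z. -/
theorem inner_chartVector_transition (g : SmoothMetric n M)
    (he : e ∈ atlas (EuclideanSpace ℝ (Fin n)) M)
    (he' : e' ∈ atlas (EuclideanSpace ℝ (Fin n)) M) {z : EuclideanSpace ℝ (Fin n)}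
    (hz : z ∈ e.target) (hz' : e.symm z ∈ e'.source) (v w : EuclideanSpace ℝ (Fin n)) :
    g.inner (e.symm z) (chartVector e z v) (chartVector e z w) =
      g.inner (e'.symm (e' (e.symm z)))
        (chartVector e' (e' (e.symm z)) (fderiv ℝ (fun y => e' (e.symm y)) z v))
        (chartVector e' (e' (e.symm z)) (fderiv ℝ (fun y => e' (e.symm y)) z w)) := by
  set f := fun y => e' (e.symm y) with hf
  have hd : MDifferentiableAt (𝓡 n) (𝓡 n) f z :=
    (differentiableAt_transition he he' hz hz').mdifferentiableAt
  have h2 : MDifferentiableAt (𝓡 n) (𝓡 n) e'.symm (f z) :=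
    (mdifferentiable_of_mem_atlas he').mdifferentiableAt_symm (e'.map_source hz')
  have hcomp := mfderiv_comp z h2 hd
  have hev : e'.symm ∘ f =ᶠ[𝓝 z] e.symm := by
    have : e.symm ⁻¹' e'.source ∈ 𝓝 z :=
      (e.continuousAt_symm hz).preimage_mem_nhds (e'.open_source.mem_nhds hz')
    filter_upwards [this] with y hy
    exact e'.left_inv hy
  have hm := hev.mfderiv_eq (I := 𝓡 n) (I' := 𝓡 n)
  rw [hcomp, mfderiv_eq_fderiv] at hm
  have key : ∀ v : EuclideanSpace ℝ (Fin n),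
      (chartVector e z v : EuclideanSpace ℝ (Fin n)) = chartVector e' (f z) (fderiv ℝ f z v) :=
    fun v => (congrArg (fun l => l v) hm).symm
  -- The two base points are equal but not definitionally so. Vectors are compared as elements of
  -- the common model space.
  have hpt : ∀ p q : M, p = q → ∀ a b : EuclideanSpace ℝ (Fin n),
      g.inner p (show TangentSpace (𝓡 n) p from a) (show TangentSpace (𝓡 n) p from b) =
      g.inner q (show TangentSpace (𝓡 n) q from a) (show TangentSpace (𝓡 n) q from b) := by
    rintro p q rfl a b; rfl
  refine (hpt _ _ (e'.left_inv hz').symm _ _).trans ?_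
  exact congrArg₂ (fun a b : EuclideanSpace ℝ (Fin n) => g.inner (e'.symm (e' (e.symm z)))
      (show TangentSpace (𝓡 n) (e'.symm (e' (e.symm z))) from a)
      (show TangentSpace (𝓡 n) (e'.symm (e' (e.symm z))) from b)) (key v) (key w)

/-- The Gram matrices are related by G = JᵀG'J, so the determinants differ by the square of the
Jacobian determinant. -/
theorem density_transition (g : SmoothMetric n M)
    (he : e ∈ atlas (EuclideanSpace ℝ (Fin n)) M)
    (he' : e' ∈ atlas (EuclideanSpace ℝ (Fin n)) M) {z : EuclideanSpace ℝ (Fin n)}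
    (hz : z ∈ e.target) (hz' : e.symm z ∈ e'.source) :
    g.density e z =
      |(fderiv ℝ (fun y => e' (e.symm y)) z).det| * g.density e' (e' (e.symm z)) := by
  set f := fun y => e' (e.symm y) with hf
  set b := (EuclideanSpace.basisFun (Fin n) ℝ).toBasis
  set J := LinearMap.toMatrix b b (fderiv ℝ f z : EuclideanSpace ℝ (Fin n) →ₗ[ℝ] _) with hJ
  have hG : g.gram e z = J.transpose * g.gram e' (f z) * J := by
    ext i j
    have h1 : g.gram e z i j = _ := g.inner_chartVector_transition he he' hz hz'
      (EuclideanSpace.single i 1) (EuclideanSpace.single j 1)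
    rw [h1, gram_mulVec_dotProduct]
    have hJc : ∀ k j, J k j = (fderiv ℝ f z (EuclideanSpace.single j 1)) k := by
      intro k j
      simp [hJ, LinearMap.toMatrix_apply, b]
    simp only [Matrix.mul_apply, Matrix.transpose_apply, dotProduct, Matrix.mulVec, hJc,
      Finset.mul_sum, Finset.sum_mul]
    rw [Finset.sum_comm]
    refine Finset.sum_congr rfl fun k _ => Finset.sum_congr rfl fun l _ => ?_
    ring
  have hdet : J.det = (fderiv ℝ f z).det := LinearMap.det_toMatrix b _
  rw [density, hG, Matrix.det_mul, Matrix.det_mul, Matrix.det_transpose, hdet, density]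
  rw [show ∀ a b : ℝ, a * b * a = a ^ 2 * b by intros; ring, Real.sqrt_mul (sq_nonneg _),
    Real.sqrt_sq_eq_abs]

section Volume

variable [MeasurableSpace M] [BorelSpace M]

theorem chartVolume_apply (g : SmoothMetric n M)
    (e : OpenPartialHomeomorph M (EuclideanSpace ℝ (Fin n))) {A : Set M}
    (hA : MeasurableSet A) :
    g.chartVolume e A =
      ∫⁻ z in e.symm ⁻¹' A ∩ e.target, ENNReal.ofReal (g.density e z) := by
  rw [chartVolume, Measure.map_apply_of_aemeasurable (aemeasurable_symm e) hA,
    withDensity_apply', Measure.restrict_restrict' e.open_target.measurableSet]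
  rfl

/-- Change of variables along the transition map: its Jacobian is exactly the factor by which the
two densities differ. -/
theorem chartVolume_apply_eq (g : SmoothMetric n M)
    (he : e ∈ atlas (EuclideanSpace ℝ (Fin n)) M)
    (he' : e' ∈ atlas (EuclideanSpace ℝ (Fin n)) M) {A : Set M} (hA : MeasurableSet A)
    (hAe : A ⊆ e.source) (hAe' : A ⊆ e'.source) : g.chartVolume e A = g.chartVolume e' A := by
  rw [chartVolume_apply g e hA, chartVolume_apply g e' hA]
  have himg : e'.symm ⁻¹' A ∩ e'.target =
      (fun y => e' (e.symm y)) '' (e.symm ⁻¹' A ∩ e.target) := by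
    ext y
    constructor
    · rintro ⟨h1, h2⟩
      refine ⟨e (e'.symm y), ⟨?_, e.map_source (hAe h1)⟩, ?_⟩
      · simpa [e.left_inv (hAe h1)] using h1
      · simp [e.left_inv (hAe h1), e'.right_inv h2]
    · rintro ⟨z, ⟨h1, h2⟩, rfl⟩
      exact ⟨by simpa [e'.left_inv (hAe' h1)] using h1, e'.map_source (hAe' h1)⟩
  rw [himg, lintegral_image_eq_lintegral_abs_det_fderiv_mul volume
    (measurableSet_symm_preimage e hA) (f' := fderiv ℝ (fun y => e' (e.symm y)))]
  · refine setLIntegral_congr_fun (measurableSet_symm_preimage e hA) fun z hz => ?_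
    rw [← ENNReal.ofReal_mul (abs_nonneg _), ← density_transition g he he' hz.2 (hAe' hz.1)]
  · exact fun z hz =>
      (differentiableAt_transition he he' hz.2 (hAe' hz.1)).hasFDerivAt.hasFDerivWithinAt
  · intro z hz y hy h
    exact e.symm.injOn hz.2 hy.2 (e'.injOn (hAe' hz.1) (hAe' hy.1) h)

/-- A supremum of measures is controlled by exhibiting an upper bound. The chart volume plus the
restriction of `vol` to the complement of the domain dominates every other chart volume, since chart
volumes agree on overlaps, and on the domain this bound reduces to the chart volume. -/
theorem vol_restrict_source (g : SmoothMetric n M) (c : M) :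
    g.vol.restrict (chartAt (EuclideanSpace ℝ (Fin n)) c).source =
      g.chartVolume (chartAt (EuclideanSpace ℝ (Fin n)) c) := by
  set e := chartAt (EuclideanSpace ℝ (Fin n)) c with he
  have hS : MeasurableSet e.source := e.open_source.measurableSet
  have hoff : ∀ s, MeasurableSet s → g.chartVolume e s = g.chartVolume e (s ∩ e.source) := by
    intro s hs
    rw [chartVolume_apply g e hs, chartVolume_apply g e (hs.inter hS)]
    congr 2
    ext z
    constructor
    · rintro ⟨h1, h2⟩; exact ⟨⟨h1, e.map_target h2⟩, h2⟩
    · rintro ⟨h1, h2⟩; exact ⟨h1.1, h2⟩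
  have hle : g.vol ≤ g.chartVolume e + g.vol.restrict e.sourceᶜ := by
    refine iSup_le fun c' => Measure.le_iff.2 fun s hs => ?_
    rw [Measure.add_apply, Measure.restrict_apply hs,
      ← measure_inter_add_sdiff s hS (μ := g.chartVolume _)]
    refine add_le_add ?_ (Measure.le_iff'.1 (le_iSup (fun c' : M => g.chartVolume
      (chartAt (EuclideanSpace ℝ (Fin n)) c')) c') _)
    set e' := chartAt (EuclideanSpace ℝ (Fin n)) c' with he'
    have hS' : MeasurableSet e'.source := e'.open_source.measurableSet
    have h1 : g.chartVolume e' (s ∩ e.source) =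
        g.chartVolume e' (s ∩ e.source ∩ e'.source) := by
      rw [chartVolume_apply g e' (hs.inter hS), chartVolume_apply g e' ((hs.inter hS).inter hS')]
      congr 2
      ext z
      constructor
      · rintro ⟨h1, h2⟩; exact ⟨⟨h1, e'.map_target h2⟩, h2⟩
      · rintro ⟨h1, h2⟩; exact ⟨h1.1, h2⟩
    rw [h1, g.chartVolume_apply_eq (chart_mem_atlas _ c') (chart_mem_atlas _ c)
      ((hs.inter hS).inter hS') inter_subset_right
      (inter_subset_left.trans inter_subset_right)]
    exact measure_mono (inter_subset_left.trans inter_subset_left)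
  refine le_antisymm ?_ (Measure.le_iff.2 fun s hs => ?_)
  · refine Measure.le_iff.2 fun s hs => ?_
    rw [Measure.restrict_apply hs]
    refine (Measure.le_iff'.1 hle _).trans ?_
    rw [Measure.add_apply, Measure.restrict_apply (hs.inter hS), inter_assoc, inter_compl_self,
      inter_empty, measure_empty, add_zero]
    exact measure_mono inter_subset_left
  · rw [hoff s hs, Measure.restrict_apply hs]
    exact Measure.le_iff'.1 (le_iSup (fun c' : M => g.chartVolume
      (chartAt (EuclideanSpace ℝ (Fin n)) c')) c) _

end Volume

end SmoothMetric

/-! ### Integrals and null sets in coordinates. -/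

namespace SmoothMetric

variable {n : ℕ} {M : Type*} [TopologicalSpace M]
  [ChartedSpace (EuclideanSpace ℝ (Fin n)) M] [IsManifold (𝓡 n) ∞ M]

/-- The Riemannian volume in the coordinates of the chart `e`. -/
def coordVolume (g : SmoothMetric n M) (e : OpenPartialHomeomorph M (EuclideanSpace ℝ (Fin n))) :
    Measure (EuclideanSpace ℝ (Fin n)) :=
  (volume.restrict e.target).withDensity fun z => ENNReal.ofReal (g.density e z)

theorem coordVolume_ac (g : SmoothMetric n M)
    (e : OpenPartialHomeomorph M (EuclideanSpace ℝ (Fin n))) :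
    g.coordVolume e ≪ volume.restrict e.target :=
  withDensity_absolutelyContinuous _ _

theorem aemeasurable_density (g : SmoothMetric n M) (c : M) :
    AEMeasurable (g.density (chartAt (EuclideanSpace ℝ (Fin n)) c))
      (volume.restrict (chartAt (EuclideanSpace ℝ (Fin n)) c).target) :=
  (g.continuousOn_density (chart_mem_atlas _ c)).aemeasurable
    (chartAt (EuclideanSpace ℝ (Fin n)) c).open_target.measurableSet

theorem ac_coordVolume (g : SmoothMetric n M) (c : M) :
    volume.restrict (chartAt (EuclideanSpace ℝ (Fin n)) c).target ≪
      g.coordVolume (chartAt (EuclideanSpace ℝ (Fin n)) c) := by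
  refine withDensity_absolutelyContinuous' (g.aemeasurable_density c).ennreal_ofReal ?_
  filter_upwards [ae_restrict_mem (chartAt (EuclideanSpace ℝ (Fin n)) c).open_target.measurableSet]
    with z hz
  simpa using g.density_pos (chart_mem_atlas _ c) hz

section Volume

variable [MeasurableSpace M] [BorelSpace M]

theorem map_symm_coordVolume (g : SmoothMetric n M) (c : M) :
    (g.coordVolume (chartAt (EuclideanSpace ℝ (Fin n)) c)).map
        (chartAt (EuclideanSpace ℝ (Fin n)) c).symm =
      g.vol.restrict (chartAt (EuclideanSpace ℝ (Fin n)) c).source :=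
  (g.vol_restrict_source c).symm

theorem aemeasurable_chart (g : SmoothMetric n M) (c : M) :
    AEMeasurable (chartAt (EuclideanSpace ℝ (Fin n)) c)
      (g.vol.restrict (chartAt (EuclideanSpace ℝ (Fin n)) c).source) :=
  (chartAt (EuclideanSpace ℝ (Fin n)) c).continuousOn.aemeasurable
    (chartAt (EuclideanSpace ℝ (Fin n)) c).open_source.measurableSet

theorem map_chart_vol (g : SmoothMetric n M) (c : M) :
    (g.vol.restrict (chartAt (EuclideanSpace ℝ (Fin n)) c).source).map
        (chartAt (EuclideanSpace ℝ (Fin n)) c) =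
      g.coordVolume (chartAt (EuclideanSpace ℝ (Fin n)) c) := by
  have h := g.aemeasurable_chart c
  rw [← map_symm_coordVolume] at h ⊢
  rw [AEMeasurable.map_map_of_aemeasurable h (aemeasurable_symm _)]
  conv_rhs => rw [← Measure.map_id (μ := g.coordVolume _)]
  refine Measure.map_congr ((g.coordVolume_ac _).ae_le ?_)
  filter_upwards [ae_restrict_mem (chartAt (EuclideanSpace ℝ (Fin n)) c).open_target.measurableSet]
    with z hz using (chartAt (EuclideanSpace ℝ (Fin n)) c).right_inv hz

/-- The density is positive on the target, so the coordinate volume and Lebesgue measure have the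
same null sets there. -/
theorem ae_comp_symm_iff (g : SmoothMetric n M) (c : M) {p : M → Prop} :
    (∀ᵐ z ∂volume.restrict (chartAt (EuclideanSpace ℝ (Fin n)) c).target,
        p ((chartAt (EuclideanSpace ℝ (Fin n)) c).symm z)) ↔
      ∀ᵐ x ∂g.vol.restrict (chartAt (EuclideanSpace ℝ (Fin n)) c).source, p x := by
  set e := chartAt (EuclideanSpace ℝ (Fin n)) c with he
  constructor
  · intro h
    have h1 : ∀ᵐ z ∂((g.vol.restrict e.source).map e), p (e.symm z) := by
      rw [he, map_chart_vol]
      exact (g.coordVolume_ac e).ae_le h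
    have h2 := ae_of_ae_map (g.aemeasurable_chart c) h1
    filter_upwards [h2, ae_restrict_mem e.open_source.measurableSet] with x hx hxs
    rwa [← he, e.left_inv hxs] at hx
  · intro h
    rw [he, ← map_symm_coordVolume] at h
    exact (g.ac_coordVolume c).ae_le (ae_of_ae_map (aemeasurable_symm _) h)

theorem integrable_coordVolume_iff (g : SmoothMetric n M) (c : M) {F : M → ℝ} :
    Integrable (fun z => F ((chartAt (EuclideanSpace ℝ (Fin n)) c).symm z))
        (g.coordVolume (chartAt (EuclideanSpace ℝ (Fin n)) c)) ↔
      IntegrableOn F (chartAt (EuclideanSpace ℝ (Fin n)) c).source g.vol := by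
  set e := chartAt (EuclideanSpace ℝ (Fin n)) c with he
  constructor
  · intro h
    rw [he, ← map_chart_vol] at h
    have h2 := h.comp_aemeasurable (g.aemeasurable_chart c)
    refine h2.congr ?_
    filter_upwards [ae_restrict_mem e.open_source.measurableSet] with x hx
    simp [e, e.left_inv hx]
  · intro h
    rw [IntegrableOn, he, ← map_symm_coordVolume] at h
    exact h.comp_aemeasurable (aemeasurable_symm _)

/-- Integrability on the domain of a chart, in coordinates. -/
theorem integrableOn_source_iff (g : SmoothMetric n M) (c : M) {F : M → ℝ} :
    IntegrableOn F (chartAt (EuclideanSpace ℝ (Fin n)) c).source g.vol ↔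
      IntegrableOn (fun z => g.density (chartAt (EuclideanSpace ℝ (Fin n)) c) z *
        F ((chartAt (EuclideanSpace ℝ (Fin n)) c).symm z))
        (chartAt (EuclideanSpace ℝ (Fin n)) c).target := by
  rw [← integrable_coordVolume_iff, coordVolume, integrable_withDensity_iff_integrable_smul₀'
    (g.aemeasurable_density c).ennreal_ofReal (by simp), IntegrableOn]
  simp [ENNReal.toReal_ofReal (Real.sqrt_nonneg _), density]

/-- The integral over the domain of a chart, in coordinates. -/
theorem setIntegral_source (g : SmoothMetric n M) (c : M) (F : M → ℝ) :
    ∫ x in (chartAt (EuclideanSpace ℝ (Fin n)) c).source, F x ∂g.vol =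
      ∫ z in (chartAt (EuclideanSpace ℝ (Fin n)) c).target,
        g.density (chartAt (EuclideanSpace ℝ (Fin n)) c) z *
          F ((chartAt (EuclideanSpace ℝ (Fin n)) c).symm z) := by
  by_cases hF : IntegrableOn F (chartAt (EuclideanSpace ℝ (Fin n)) c).source g.vol
  · have hm := hF.aestronglyMeasurable
    rw [← map_symm_coordVolume] at hm ⊢
    rw [integral_map (by exact aemeasurable_symm _) hm, coordVolume,
      integral_withDensity_eq_integral_toReal_smul₀
        (g.aemeasurable_density c).ennreal_ofReal (by simp)]
    simp [ENNReal.toReal_ofReal (Real.sqrt_nonneg _), density]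
  -- If one side is not integrable neither is the other, and both integrals take the default value
  -- 0.
  · rw [integral_undef hF, integral_undef (fun h => hF ((g.integrableOn_source_iff c).2 h))]

/-- Local integrability on an open subset of the manifold can be checked in the charts. -/
theorem locallyIntegrableOn_of_charts (g : SmoothMetric n M) {U : Set M} (hU : IsOpen U)
    {F : M → ℝ} (h : ∀ c : M, LocallyIntegrableOn
      (fun z => F ((chartAt (EuclideanSpace ℝ (Fin n)) c).symm z))
      ((chartAt (EuclideanSpace ℝ (Fin n)) c).target ∩
        (chartAt (EuclideanSpace ℝ (Fin n)) c).symm ⁻¹' U)) :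
    LocallyIntegrableOn F U g.vol := by
  intro x hx
  set e := chartAt (EuclideanSpace ℝ (Fin n)) x with he
  have hW : IsOpen (e.target ∩ e.symm ⁻¹' U) := e.isOpen_inter_preimage_symm hU
  have hxs : x ∈ e.source := mem_chart_source _ x
  have hxW : e x ∈ e.target ∩ e.symm ⁻¹' U := ⟨e.map_source hxs, by simpa [e.left_inv hxs]⟩
  -- On a compact coordinate ball the density is continuous, hence bounded, so it may multiply the
  -- integrable coordinate expression.
  obtain ⟨r, hr, hrW⟩ := Metric.nhds_basis_closedBall.mem_iff.1 (hW.mem_nhds hxW)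
  set B := Metric.closedBall (e x) r with hB
  have hBc : IsCompact B := isCompact_closedBall _ _
  have hBt : B ⊆ e.target := hrW.trans inter_subset_left
  have hFB : IntegrableOn (fun z => F (e.symm z)) B := (h x).integrableOn_compact_subset hrW hBc
  have hDB : IntegrableOn (fun z => g.density e z * F (e.symm z)) B :=
    hFB.continuousOn_mul ((g.continuousOn_density (chart_mem_atlas _ x)).mono hBt) hBc
  have hA := measurableSet_chart_preimage e hBc.measurableSet
  refine ⟨e.source ∩ e ⁻¹' B, mem_nhdsWithin_of_mem_nhds (inter_mem (e.open_source.mem_nhds hxs)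
    ((e.continuousAt hxs).preimage_mem_nhds (Metric.closedBall_mem_nhds _ hr))), ?_⟩
  rw [← integrable_indicator_iff hA]
  have h1 : IntegrableOn ((e.source ∩ e ⁻¹' B).indicator F) e.source g.vol := by
    rw [he, integrableOn_source_iff, ← he]
    rw [← integrable_indicator_iff hBc.measurableSet] at hDB
    refine hDB.integrableOn.congr_fun (fun z hz => ?_) e.open_target.measurableSet
    by_cases hzB : z ∈ B
    · simp [hzB, indicator, e.map_target hz, e.right_inv hz]
    · simp [hzB, indicator, e.right_inv hz]
  rw [← integrableOn_iff_integrable_of_support_subset (s := e.source)]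
  · exact h1
  · exact (support_indicator_subset).trans inter_subset_left

end Volume

end SmoothMetric

/-! ### Locally bounded functions as multipliers. -/

section Dominated

variable {X : Type*} [TopologicalSpace X] [MeasurableSpace X]

/-- `b` is measurable on `U` and its absolute value is almost everywhere at most a function which
is continuous on `U`. -/
def IsDominatedOn (μ : Measure X) (U : Set X) (b : X → ℝ) : Prop :=
  AEStronglyMeasurable b (μ.restrict U) ∧
    ∃ h : X → ℝ, ContinuousOn h U ∧ ∀ᵐ x ∂μ.restrict U, |b x| ≤ h x

variable {μ : Measure X} {U : Set X} {b b' : X → ℝ}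

theorem ContinuousOn.isDominatedOn [BorelSpace X] [SecondCountableTopology X] (hb : ContinuousOn b U)
    (hU : MeasurableSet U) : IsDominatedOn μ U b :=
  ⟨hb.aestronglyMeasurable hU, fun x => |b x|, hb.abs, Eventually.of_forall fun _ => le_rfl⟩

theorem IsDominatedOn.mul (hb : IsDominatedOn μ U b) (hb' : IsDominatedOn μ U b') :
    IsDominatedOn μ U (fun x => b x * b' x) := by
  obtain ⟨h1, h, hc, hle⟩ := hb
  obtain ⟨h1', h', hc', hle'⟩ := hb'
  refine ⟨h1.mul h1', fun x => h x * h' x, hc.mul hc', ?_⟩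
  filter_upwards [hle, hle'] with x hx hx'
  rw [abs_mul]
  exact mul_le_mul hx hx' (abs_nonneg _) ((abs_nonneg _).trans hx)

theorem IsDominatedOn.neg (hb : IsDominatedOn μ U b) : IsDominatedOn μ U (fun x => -b x) := by
  obtain ⟨h1, h, hc, hle⟩ := hb
  exact ⟨h1.neg, h, hc, by simpa only [abs_neg] using hle⟩

theorem IsDominatedOn.sum {ι : Type*} (s : Finset ι) {f : ι → X → ℝ}
    (hf : ∀ i, IsDominatedOn μ U (f i)) : IsDominatedOn μ U (fun x => ∑ i ∈ s, f i x) := by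
  choose h1 h hc hle using hf
  refine ⟨Finset.aestronglyMeasurable_fun_sum s fun i _ => h1 i, fun x => ∑ i ∈ s, h i x,
    continuousOn_finsetSum _ fun i _ => hc i, ?_⟩
  have hall : ∀ᵐ x ∂μ.restrict U, ∀ i ∈ s, |f i x| ≤ h i x :=
    (Filter.eventually_all_finset s).2 fun i _ => hle i
  filter_upwards [hall] with x hx
  exact (Finset.abs_sum_le_sum_abs _ _).trans (Finset.sum_le_sum hx)

theorem IsDominatedOn.rpow_abs (hb : IsDominatedOn μ U b) {p : ℝ} (hp : 0 ≤ p) :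
    IsDominatedOn μ U (fun x => |b x| ^ p) := by
  obtain ⟨h1, h, hc, hle⟩ := hb
  refine ⟨(Real.continuous_rpow_const hp).comp_aestronglyMeasurable h1.norm,
    fun x => |h x| ^ p, hc.abs.rpow_const fun _ _ => Or.inr hp, ?_⟩
  filter_upwards [hle] with x hx
  rw [abs_of_nonneg (Real.rpow_nonneg (abs_nonneg _) _)]
  exact Real.rpow_le_rpow (abs_nonneg _) (hx.trans (le_abs_self _)) hp

/-- The product of a locally integrable function and a locally bounded one is locally
integrable. -/
theorem IsDominatedOn.mul_locallyIntegrableOn [BorelSpace X] {f : X → ℝ} (hU : IsOpen U)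
    (hb : IsDominatedOn μ U b) (hf : LocallyIntegrableOn f U μ) :
    LocallyIntegrableOn (fun x => b x * f x) U μ := by
  obtain ⟨h1, h, hc, hle⟩ := hb
  intro x hx
  obtain ⟨t, ht, hft⟩ := hf x hx
  have h2 : {y | h y < h x + 1} ∈ 𝓝[U] x :=
    (hc x hx).eventually (eventually_lt_nhds (lt_add_one (h x)))
  obtain ⟨O, hO, hxO, hOU⟩ := mem_nhdsWithin.1 (inter_mem ht h2)
  refine ⟨O ∩ U, inter_mem (mem_nhdsWithin_of_mem_nhds (hO.mem_nhds hxO))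
    self_mem_nhdsWithin, ?_⟩
  have hsub : O ∩ U ⊆ t := fun y hy => (hOU hy).1
  refine Integrable.bdd_mul (c := h x + 1) (hft.mono_set hsub)
    (h1.mono_measure (Measure.restrict_mono inter_subset_right le_rfl)) ?_
  have h3 := ae_restrict_of_ae_restrict_of_subset (inter_subset_right (s := O)) hle
  filter_upwards [h3, ae_restrict_mem (hO.inter hU).measurableSet] with y hy hyO
  exact hy.trans (hOU hyO).2.le

theorem MeasureTheory.LocallyIntegrableOn.finset_sum {ι : Type*} (s : Finset ι)
    {f : ι → X → ℝ} (hf : ∀ i, LocallyIntegrableOn (f i) U μ) :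
    LocallyIntegrableOn (fun x => ∑ i ∈ s, f i x) U μ := by
  classical
  induction s using Finset.induction_on with
  | empty => exact fun x _ => ⟨U, self_mem_nhdsWithin, by simp⟩
  | insert i s hi ih =>
    simp only [Finset.sum_insert hi]
    exact (hf i).add ih

theorem MeasureTheory.LocallyIntegrableOn.integrable_of_eq_zero {f : X → ℝ}
    (hf : LocallyIntegrableOn f U μ) {K : Set X} (hK : IsCompact K) (hKU : K ⊆ U)
    (h0 : ∀ x, x ∉ K → f x = 0) : Integrable f μ :=
  (integrableOn_iff_integrable_of_support_subset fun x hx => by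
    by_contra h; exact hx (h0 x h)).1 (hf.integrableOn_compact_subset hKU hK)

end Dominated

theorem IsDominatedOn.isLocallyEssBoundedOn {E : Type*} [NormedAddCommGroup E]
    [InnerProductSpace ℝ E] [FiniteDimensional ℝ E] [MeasurableSpace E] [BorelSpace E]
    {f : E → ℝ} {W : Set E} (hf : IsDominatedOn volume W f) : IsLocallyEssBoundedOn f W := by
  obtain ⟨-, h, hc, hle⟩ := hf
  intro K hKW hK
  obtain ⟨B, hB⟩ := hK.exists_bound_of_continuousOn (hc.mono hKW)
  refine ⟨B, ?_⟩
  filter_upwards [ae_restrict_of_ae_restrict_of_subset hKW hle,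
    ae_restrict_mem hK.measurableSet] with z hz hzK
  exact hz.trans ((le_abs_self _).trans (hB z hzK))

/-! ### Calculus of gradients. -/

namespace SmoothMetric

variable {n : ℕ} {M : Type*} [TopologicalSpace M]
  [ChartedSpace (EuclideanSpace ℝ (Fin n)) M] [IsManifold (𝓡 n) ∞ M]

section Gradient

theorem inner_grad' (g : SmoothMetric n M) (f : M → ℝ) (x : M) (w : TangentSpace (𝓡 n) x) :
    g.inner x w (g.grad f x) = mfderiv (𝓡 n) 𝓘(ℝ, ℝ) f x w := by
  rw [g.symm, inner_grad]

/-- Cauchy–Schwarz from the discriminant of the nonnegative quadratic t ↦ |X + tY|². -/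
theorem inner_mul_inner_self_le (g : SmoothMetric n M) (x : M) (X Y : TangentSpace (𝓡 n) x) :
    g.inner x X Y ^ 2 ≤ g.inner x X X * g.inner x Y Y := by
  have hnn : ∀ Z : TangentSpace (𝓡 n) x, 0 ≤ g.inner x Z Z := by
    intro Z
    by_cases hZ : Z = 0
    · simp [hZ]
    · exact (g.pos x Z hZ).le
  have h : ∀ t : ℝ, 0 ≤ g.inner x Y Y * (t * t) + 2 * g.inner x X Y * t + g.inner x X X := by
    intro t
    have := hnn (X + t • Y)
    simp only [map_add, map_smul, _root_.add_apply, _root_.smul_apply, smul_eq_mul,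
      g.symm x Y X] at this
    linarith
  have := discrim_le_zero h
  rw [discrim] at this
  nlinarith

theorem abs_inner_le (g : SmoothMetric n M) (x : M) (X Y : TangentSpace (𝓡 n) x) :
    |g.inner x X Y| ≤ g.vnorm x X * g.vnorm x Y := by
  have h0 : 0 ≤ g.inner x X X := by
    by_cases hZ : X = 0
    · simp [hZ]
    · exact (g.pos x X hZ).le
  rw [vnorm, vnorm, ← Real.sqrt_mul h0]
  exact Real.abs_le_sqrt (g.inner_mul_inner_self_le x X Y)

theorem inner_grad_mul (g : SmoothMetric n M) {f h : M → ℝ} {x : M}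
    (hf : MDifferentiableAt (𝓡 n) 𝓘(ℝ, ℝ) f x) (hh : MDifferentiableAt (𝓡 n) 𝓘(ℝ, ℝ) h x)
    (X : TangentSpace (𝓡 n) x) :
    g.inner x X (g.grad (fun y => f y * h y) x) =
      f x * g.inner x X (g.grad h x) + h x * g.inner x X (g.grad f x) := by
  simp only [inner_grad']
  have h1 := (hf.hasMFDerivAt.mul hh.hasMFDerivAt).mfderiv
  exact congrArg (fun l => l X) h1

theorem inner_grad_comp (g : SmoothMetric n M) {f : M → ℝ} {x : M} {F : ℝ → ℝ} {F' : ℝ}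
    (hF : HasDerivAt F F' (f x)) (hf : MDifferentiableAt (𝓡 n) 𝓘(ℝ, ℝ) f x)
    (X : TangentSpace (𝓡 n) x) :
    g.inner x X (g.grad (fun y => F (f y)) x) = F' * g.inner x X (g.grad f x) := by
  simp only [inner_grad']
  have h1 := (hF.hasFDerivAt.hasMFDerivAt.comp x hf.hasMFDerivAt).mfderiv
  have h2 := congrArg (fun l => l X) h1
  exact h2.trans (mul_comm (G := ℝ) _ _)

theorem inner_grad_add (g : SmoothMetric n M) {f h : M → ℝ} {x : M}
    (hf : MDifferentiableAt (𝓡 n) 𝓘(ℝ, ℝ) f x) (hh : MDifferentiableAt (𝓡 n) 𝓘(ℝ, ℝ) h x)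
    (X : TangentSpace (𝓡 n) x) :
    g.inner x X (g.grad (fun y => f y + h y) x) =
      g.inner x X (g.grad f x) + g.inner x X (g.grad h x) := by
  simp only [inner_grad']
  exact congrArg (fun l => l X) (hf.hasMFDerivAt.add hh.hasMFDerivAt).mfderiv

theorem inner_grad_sum (g : SmoothMetric n M) {ι : Type*} (s : Finset ι) {f : ι → M → ℝ} {x : M}
    (hf : ∀ i, MDifferentiableAt (𝓡 n) 𝓘(ℝ, ℝ) (f i) x) (X : TangentSpace (𝓡 n) x) :
    MDifferentiableAt (𝓡 n) 𝓘(ℝ, ℝ) (fun y => ∑ i ∈ s, f i y) x ∧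
    g.inner x X (g.grad (fun y => ∑ i ∈ s, f i y) x) =
      ∑ i ∈ s, g.inner x X (g.grad (f i) x) := by
  classical
  induction s using Finset.induction_on with
  | empty =>
    refine ⟨by simpa using mdifferentiableAt_const, ?_⟩
    simp only [inner_grad', Finset.sum_empty, mfderiv_const]
    rfl
  | insert i s hi ih =>
    simp only [Finset.sum_insert hi]
    exact ⟨(hf i).add ih.1, by rw [g.inner_grad_add (hf i) ih.1, ih.2]⟩

theorem inner_grad_eq_zero (g : SmoothMetric n M) {f : M → ℝ} {x : M} (hx : x ∉ tsupport f)
    (X : TangentSpace (𝓡 n) x) : g.inner x X (g.grad f x) = 0 := by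
  have h : f =ᶠ[𝓝 x] fun _ => 0 := notMem_tsupport_iff_eventuallyEq.1 hx
  rw [inner_grad', h.mfderiv_eq, mfderiv_const]
  rfl

/-- The inner product with a gradient, in coordinates. -/
theorem inner_grad_symm (g : SmoothMetric n M)
    {e : OpenPartialHomeomorph M (EuclideanSpace ℝ (Fin n))}
    (he : e ∈ atlas (EuclideanSpace ℝ (Fin n)) M) {z : EuclideanSpace ℝ (Fin n)}
    (hz : z ∈ e.target) {f : M → ℝ} (hf : MDifferentiableAt (𝓡 n) 𝓘(ℝ, ℝ) f (e.symm z))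
    (X : TangentSpace (𝓡 n) (e.symm z)) :
    g.inner (e.symm z) X (g.grad f (e.symm z)) = ∑ j, (∑ i, g.inner (e.symm z) X
      (chartVector e z (EuclideanSpace.single i 1)) * (g.gram e z)⁻¹ i j) *
      fderiv ℝ (fun y => f (e.symm y)) z (EuclideanSpace.single j 1) := by
  rw [g.inner_eq_sum_inv_gram he hz]
  simp_rw [inner_grad, mfderiv_chartVector he hz hf]

theorem contDiffOn_comp_symm {e : OpenPartialHomeomorph M (EuclideanSpace ℝ (Fin n))}
    (he : e ∈ atlas (EuclideanSpace ℝ (Fin n)) M) {f : M → ℝ}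
    (hf : ContMDiff (𝓡 n) 𝓘(ℝ, ℝ) ∞ f) : ContDiffOn ℝ ∞ (fun z => f (e.symm z)) e.target :=
  contMDiffOn_iff_contDiffOn.1 (hf.comp_contMDiffOn
    (contMDiffOn_symm_of_mem_maximalAtlas (IsManifold.subset_maximalAtlas he)))

theorem continuousOn_fderiv_comp_symm
    {e : OpenPartialHomeomorph M (EuclideanSpace ℝ (Fin n))}
    (he : e ∈ atlas (EuclideanSpace ℝ (Fin n)) M) {f : M → ℝ}
    (hf : ContMDiff (𝓡 n) 𝓘(ℝ, ℝ) ∞ f) (v : EuclideanSpace ℝ (Fin n)) :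
    ContinuousOn (fun z => fderiv ℝ (fun y => f (e.symm y)) z v) e.target :=
  ((contDiffOn_comp_symm he hf).continuousOn_fderiv_of_isOpen e.open_target (by simp)).clm_apply
    continuousOn_const

/-- The gradient is chosen point by point, so its regularity has to be read off from the coordinate
formula with the inverse Gram matrix. -/
theorem continuous_inner_grad_self (g : SmoothMetric n M) {f : M → ℝ}
    (hf : ContMDiff (𝓡 n) 𝓘(ℝ, ℝ) ∞ f) :
    Continuous fun x => g.inner x (g.grad f x) (g.grad f x) := by
  rw [continuous_iff_continuousAt]
  intro x
  set e := chartAt (EuclideanSpace ℝ (Fin n)) x with hedef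
  have he : e ∈ atlas (EuclideanSpace ℝ (Fin n)) M := chart_mem_atlas _ x
  have h1 : ContinuousOn (fun z => g.inner (e.symm z) (g.grad f (e.symm z))
      (g.grad f (e.symm z))) e.target := by
    refine ContinuousOn.congr (f := fun z => ∑ j, (∑ i,
      fderiv ℝ (fun y => f (e.symm y)) z (EuclideanSpace.single i 1) * (g.gram e z)⁻¹ i j) *
      fderiv ℝ (fun y => f (e.symm y)) z (EuclideanSpace.single j 1)) ?_ fun z hz => ?_
    · exact continuousOn_finsetSum _ fun j _ => (continuousOn_finsetSum _ fun i _ =>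
        (continuousOn_fderiv_comp_symm he hf _).mul (g.continuousOn_inv_gram_apply he i j)).mul
        (continuousOn_fderiv_comp_symm he hf _)
    · have hfz := hf.mdifferentiable (by simp) (e.symm z)
      simp only
      rw [g.inner_grad_symm he hz hfz]
      simp_rw [inner_grad, mfderiv_chartVector he hz hfz]
  have h2 : ContinuousOn (fun y => g.inner y (g.grad f y) (g.grad f y)) e.source := by
    refine (h1.comp e.continuousOn e.mapsTo).congr fun y hy => ?_
    simp only [Function.comp]
    rw [e.left_inv hy]
  exact h2.continuousAt (e.open_source.mem_nhds (mem_chart_source _ x))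

theorem continuous_vnorm_grad (g : SmoothMetric n M) {f : M → ℝ}
    (hf : ContMDiff (𝓡 n) 𝓘(ℝ, ℝ) ∞ f) : Continuous fun x => g.vnorm x (g.grad f x) :=
  (g.continuous_inner_grad_self hf).sqrt

end Gradient

end SmoothMetric

/-! ### Test functions and weak gradients in charts. -/

namespace SmoothMetric

variable {n : ℕ} {M : Type*} [TopologicalSpace M]
  [ChartedSpace (EuclideanSpace ℝ (Fin n)) M]

section TestFunctions

variable [IsManifold (𝓡 n) ∞ M] {e : OpenPartialHomeomorph M (EuclideanSpace ℝ (Fin n))}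

/-- A test function in the coordinates of a chart, as a test function on the manifold. -/
theorem isTestFunctionOn_indicator_comp [T2Space M]
    (he : e ∈ atlas (EuclideanSpace ℝ (Fin n)) M) {U : Set M}
    {P : EuclideanSpace ℝ (Fin n) → ℝ} (hP : ContDiff ℝ ∞ P) (hPc : HasCompactSupport P)
    (hPW : tsupport P ⊆ e.target ∩ e.symm ⁻¹' U) :
    IsTestFunctionOn (n := n) U (e.source.indicator fun x => P (e x)) ∧
      tsupport (e.source.indicator fun x => P (e x)) ⊆ e.source := by
  set f := e.source.indicator fun x => P (e x) with hf
  -- The image of the support is compact, hence closed in the Hausdorff space `M`. Therefore the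
  -- extension by zero has its support inside the chart and is smooth.
  have hK : IsCompact (e.symm '' tsupport P) :=
    hPc.isCompact.image_of_continuousOn (e.continuousOn_symm.mono (hPW.trans inter_subset_left))
  have hts : tsupport f ⊆ e.symm '' tsupport P := by
    refine closure_minimal (fun x hx => ?_) hK.isClosed
    have hxs : x ∈ e.source := by
      by_contra h
      exact hx (by simp [hf, h])
    refine ⟨e x, subset_tsupport _ ?_, e.left_inv hxs⟩
    simpa [hf, hxs] using hx
  have hsub : tsupport f ⊆ e.source := by
    rintro x hx
    obtain ⟨z, hz, rfl⟩ := hts hx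
    exact e.map_target (hPW hz).1
  refine ⟨⟨contMDiff_of_tsupport fun x hx => ?_, hK.of_isClosed_subset (isClosed_tsupport _) hts,
    fun x hx => ?_⟩, hsub⟩
  · have h1 : ContMDiffAt (𝓡 n) (𝓡 n) ∞ e x :=
      contMDiffAt_of_mem_maximalAtlas (IsManifold.subset_maximalAtlas he) (hsub hx)
    have h2 : ContMDiffAt (𝓡 n) 𝓘(ℝ, ℝ) ∞ (fun x => P (e x)) x :=
      hP.contMDiff.contMDiffAt.comp x h1
    refine h2.congr_of_eventuallyEq ?_
    filter_upwards [e.open_source.mem_nhds (hsub hx)] with y hy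
    simp [hf, hy]
  · obtain ⟨z, hz, rfl⟩ := hts hx
    exact (hPW hz).2

/-- A test function supported in the domain of a chart, in the coordinates of the chart. -/
theorem contDiff_indicator_comp_symm (he : e ∈ atlas (EuclideanSpace ℝ (Fin n)) M) {U : Set M}
    {w : M → ℝ} (hw : IsTestFunctionOn (n := n) U w) (hwe : tsupport w ⊆ e.source) :
    ContDiff ℝ ∞ (e.target.indicator fun z => w (e.symm z)) ∧
      HasCompactSupport (e.target.indicator fun z => w (e.symm z)) ∧
      tsupport (e.target.indicator fun z => w (e.symm z)) ⊆ e.target ∩ e.symm ⁻¹' U := by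
  set f := e.target.indicator fun z => w (e.symm z) with hf
  have hK : IsCompact (e '' tsupport w) :=
    hw.2.1.isCompact.image_of_continuousOn (e.continuousOn.mono hwe)
  have hts : tsupport f ⊆ e '' tsupport w := by
    refine closure_minimal (fun z hz => ?_) hK.isClosed
    have hzt : z ∈ e.target := by
      by_contra h
      exact hz (by simp [hf, h])
    refine ⟨e.symm z, subset_tsupport _ ?_, e.right_inv hzt⟩
    simpa [hf, hzt] using hz
  have hsub : tsupport f ⊆ e.target ∩ e.symm ⁻¹' U := by
    rintro z hz
    obtain ⟨x, hx, rfl⟩ := hts hz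
    exact ⟨e.map_source (hwe hx), by simpa [e.left_inv (hwe hx)] using hw.2.2 hx⟩
  refine ⟨?_, hK.of_isClosed_subset (isClosed_tsupport _) hts, hsub⟩
  rw [contDiff_iff_contDiffAt]
  intro z
  by_cases hz : z ∈ tsupport f
  · have hzt := (hsub hz).1
    refine ((contDiffOn_comp_symm he hw.1).contDiffAt
      (e.open_target.mem_nhds hzt)).congr_of_eventuallyEq ?_
    filter_upwards [e.open_target.mem_nhds hzt] with y hy
    simp [hf, hy]
  · have h : f =ᶠ[𝓝 z] fun _ => 0 := notMem_tsupport_iff_eventuallyEq.1 hz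
    exact contDiffAt_const.congr_of_eventuallyEq h

end TestFunctions

section WeakGradient

variable [IsManifold (𝓡 n) ∞ M] [MeasurableSpace M] [BorelSpace M] {g : SmoothMetric n M}
  {U : Set M} {X Y : (x : M) → TangentSpace (𝓡 n) x} {f h N : M → ℝ}

theorem ae_comp_symm_of_ae_restrict (g : SmoothMetric n M) (hU : IsOpen U) {p : M → Prop}
    (hp : ∀ᵐ x ∂g.vol.restrict U, p x) (c : M) :
    ∀ᵐ z ∂volume.restrict ((chartAt (EuclideanSpace ℝ (Fin n)) c).target ∩
        (chartAt (EuclideanSpace ℝ (Fin n)) c).symm ⁻¹' U),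
      p ((chartAt (EuclideanSpace ℝ (Fin n)) c).symm z) := by
  set e := chartAt (EuclideanSpace ℝ (Fin n)) c with he
  rw [ae_restrict_iff' hU.measurableSet] at hp
  have h1 := (g.ae_comp_symm_iff c (p := fun x => x ∈ U → p x)).2 (ae_restrict_of_ae hp)
  have h2 := ae_restrict_of_ae_restrict_of_subset
    (inter_subset_left (s := e.target) (t := e.symm ⁻¹' U)) h1
  filter_upwards [h2, ae_restrict_mem (e.isOpen_inter_preimage_symm hU).measurableSet] with z hz hzW
  exact hz hzW.2

/-- The covariant components of a bounded weak gradient are locally bounded. -/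
theorem isDominatedOn_component (hU : IsOpen U) (hX : g.IsWeakGradOn U f X)
    (hN : ContinuousOn N U) (hXN : ∀ᵐ x ∂g.vol.restrict U, g.vnorm x (X x) ≤ N x) (c : M)
    (v : EuclideanSpace ℝ (Fin n)) :
    IsDominatedOn volume ((chartAt (EuclideanSpace ℝ (Fin n)) c).target ∩
        (chartAt (EuclideanSpace ℝ (Fin n)) c).symm ⁻¹' U)
      (fun z => g.inner ((chartAt (EuclideanSpace ℝ (Fin n)) c).symm z)
        (X ((chartAt (EuclideanSpace ℝ (Fin n)) c).symm z))
        (chartVector (chartAt (EuclideanSpace ℝ (Fin n)) c) z v)) := by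
  set e := chartAt (EuclideanSpace ℝ (Fin n)) c with he
  refine ⟨((hX c).2 v).1.aestronglyMeasurable, fun z => N (e.symm z) *
    g.vnorm (e.symm z) (chartVector e z v), ?_, ?_⟩
  · refine ContinuousOn.mul ?_ ?_
    · exact hN.comp (e.continuousOn_symm.mono inter_subset_left) fun z hz => hz.2
    · exact ((g.continuousOn_gram_apply (chart_mem_atlas _ c) v v).mono inter_subset_left).sqrt
  · filter_upwards [g.ae_comp_symm_of_ae_restrict hU hXN c] with z hz
    exact (g.abs_inner_le _ _ _).trans (mul_le_mul_of_nonneg_right hz (Real.sqrt_nonneg _))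

/-- The contravariant components of a bounded weak gradient are locally bounded. -/
theorem isDominatedOn_raised_component (hU : IsOpen U) (hX : g.IsWeakGradOn U f X)
    (hN : ContinuousOn N U) (hXN : ∀ᵐ x ∂g.vol.restrict U, g.vnorm x (X x) ≤ N x) (c : M)
    (j : Fin n) :
    IsDominatedOn volume ((chartAt (EuclideanSpace ℝ (Fin n)) c).target ∩
        (chartAt (EuclideanSpace ℝ (Fin n)) c).symm ⁻¹' U)
      (fun z => ∑ i, g.inner ((chartAt (EuclideanSpace ℝ (Fin n)) c).symm z)
        (X ((chartAt (EuclideanSpace ℝ (Fin n)) c).symm z))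
        (chartVector (chartAt (EuclideanSpace ℝ (Fin n)) c) z (EuclideanSpace.single i 1)) *
        (g.gram (chartAt (EuclideanSpace ℝ (Fin n)) c) z)⁻¹ i j) :=
  IsDominatedOn.sum _ fun i => (isDominatedOn_component hU hX hN hXN c _).mul
    (((g.continuousOn_inv_gram_apply (chart_mem_atlas _ c) i j).mono
      inter_subset_left).isDominatedOn
      ((chartAt (EuclideanSpace ℝ (Fin n)) c).isOpen_inter_preimage_symm hU).measurableSet)

/-- The bounded contravariant components of `X` are contracted with the locally integrable covariant
components of `Y`; two gradients that are merely L¹ would not do. -/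
theorem locallyIntegrableOn_inner (hU : IsOpen U) (hX : g.IsWeakGradOn U f X)
    (hN : ContinuousOn N U) (hXN : ∀ᵐ x ∂g.vol.restrict U, g.vnorm x (X x) ≤ N x)
    (hY : g.IsWeakGradOn U h Y) : LocallyIntegrableOn (fun x => g.inner x (X x) (Y x)) U g.vol := by
  refine g.locallyIntegrableOn_of_charts hU fun c => ?_
  set e := chartAt (EuclideanSpace ℝ (Fin n)) c with he
  have hW : IsOpen (e.target ∩ e.symm ⁻¹' U) := e.isOpen_inter_preimage_symm hU
  refine (MeasureTheory.LocallyIntegrableOn.finset_sum Finset.univ fun j =>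
    (isDominatedOn_raised_component hU hX hN hXN c j).mul_locallyIntegrableOn hW
      ((hY c).2 (EuclideanSpace.single j 1)).1).congr ?_
  filter_upwards [ae_restrict_mem hW.measurableSet] with z hz
  exact (g.inner_eq_sum_inv_gram (chart_mem_atlas _ c) hz.1 _ _).symm

theorem isDominatedOn_inner_grad [SecondCountableTopology M] (hU : IsOpen U)
    (hX : g.IsWeakGradOn U f X)
    (hN : ContinuousOn N U) (hXN : ∀ᵐ x ∂g.vol.restrict U, g.vnorm x (X x) ≤ N x)
    {w : M → ℝ} (hw : ContMDiff (𝓡 n) 𝓘(ℝ, ℝ) ∞ w) :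
    IsDominatedOn g.vol U (fun x => g.inner x (X x) (g.grad w x)) := by
  -- Local integrability serves only to obtain measurability; the bound itself is Cauchy–Schwarz.
  have hloc : LocallyIntegrableOn (fun x => g.inner x (X x) (g.grad w x)) U g.vol := by
    refine g.locallyIntegrableOn_of_charts hU fun c => ?_
    set e := chartAt (EuclideanSpace ℝ (Fin n)) c with he
    have hW : IsOpen (e.target ∩ e.symm ⁻¹' U) := e.isOpen_inter_preimage_symm hU
    refine (MeasureTheory.LocallyIntegrableOn.finset_sum Finset.univ fun j =>
      (isDominatedOn_raised_component hU hX hN hXN c j).mul_locallyIntegrableOn hW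
        (((continuousOn_fderiv_comp_symm (chart_mem_atlas _ c) hw
          (EuclideanSpace.single j 1)).mono
            inter_subset_left).locallyIntegrableOn hW.measurableSet)).congr ?_
    filter_upwards [ae_restrict_mem hW.measurableSet] with z hz
    exact (g.inner_grad_symm (chart_mem_atlas _ c) hz.1 (hw.mdifferentiable (by simp) _) _).symm
  refine ⟨hloc.aestronglyMeasurable, fun x => N x * g.vnorm x (g.grad w x),
    hN.mul (g.continuous_vnorm_grad hw).continuousOn, ?_⟩
  filter_upwards [hXN] with x hx
  exact (g.abs_inner_le _ _ _).trans (mul_le_mul_of_nonneg_right hx (Real.sqrt_nonneg _))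

end WeakGradient

end SmoothMetric

/-! ### Testing with weakly differentiable functions on the manifold. -/

namespace SmoothMetric

variable {n : ℕ} {M : Type*} [TopologicalSpace M]
  [ChartedSpace (EuclideanSpace ℝ (Fin n)) M] [IsManifold (𝓡 n) ∞ M] [MeasurableSpace M]
  [BorelSpace M] {g : SmoothMetric n M} {U : Set M}
  {X A : (x : M) → TangentSpace (𝓡 n) x} {ρ a N : M → ℝ}

theorem integral_eq_integral_chart (g : SmoothMetric n M) (c : M) {F : M → ℝ}
    {F' : EuclideanSpace ℝ (Fin n) → ℝ}
    (hF : ∀ x, x ∉ (chartAt (EuclideanSpace ℝ (Fin n)) c).source → F x = 0)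
    (hF' : ∀ z, z ∉ (chartAt (EuclideanSpace ℝ (Fin n)) c).target → F' z = 0)
    (h : ∀ z ∈ (chartAt (EuclideanSpace ℝ (Fin n)) c).target,
      g.density (chartAt (EuclideanSpace ℝ (Fin n)) c) z *
        F ((chartAt (EuclideanSpace ℝ (Fin n)) c).symm z) = F' z) :
    ∫ x, F x ∂g.vol = ∫ z, F' z := by
  rw [← setIntegral_eq_integral_of_forall_compl_eq_zero hF, setIntegral_source,
    ← setIntegral_eq_integral_of_forall_compl_eq_zero hF']
  exact setIntegral_congr_fun
    (chartAt (EuclideanSpace ℝ (Fin n)) c).open_target.measurableSet h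

theorem isDominatedOn_inner_self (hU : IsOpen U) [SecondCountableTopology M]
    (hX : g.IsWeakGradOn U ρ X) (hN : ContinuousOn N U)
    (hXN : ∀ᵐ x ∂g.vol.restrict U, g.vnorm x (X x) ≤ N x) :
    IsDominatedOn g.vol U (fun x => g.inner x (X x) (X x)) := by
  refine ⟨(locallyIntegrableOn_inner hU hX hN hXN hX).aestronglyMeasurable,
    fun x => N x * N x, hN.mul hN, ?_⟩
  filter_upwards [hXN] with x hx
  exact (g.abs_inner_le _ _ _).trans
    (mul_le_mul hx hx (Real.sqrt_nonneg _) ((Real.sqrt_nonneg _).trans hx))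

theorem locallyIntegrableOn_of_isWeakGradOn (hU : IsOpen U) (ha : g.IsWeakGradOn U a A) :
    LocallyIntegrableOn a U g.vol :=
  g.locallyIntegrableOn_of_charts hU fun c => (ha c).1

/-- A distributional inequality `m ≤ div (κ X)` on `U`, where `X = ∇ρ` is a bounded weak
gradient, can be tested with `a ρ ^ β w`, where `a` is in `W^{1,1}_loc` and `w` is a test function
which is supported in the domain of a chart. -/
theorem integral_le_of_forall_test_of_tsupport_subset_source [T2Space M] (hU : IsOpen U)
    (hX : g.IsWeakGradOn U ρ X) (hN : ContinuousOn N U)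
    (hXN : ∀ᵐ x ∂g.vol.restrict U, g.vnorm x (X x) ≤ N x) (hA : g.IsWeakGradOn U a A)
    (ha0 : ∀ x, 0 ≤ a x) (hρ : ContinuousOn ρ U) (hρ0 : ∀ x ∈ U, 0 < ρ x) {m κ : M → ℝ}
    (hm : ContinuousOn m U) (hκ : ContinuousOn κ U)
    (htest : ∀ P : M → ℝ, IsTestFunctionOn (n := n) U P → (∀ x, 0 ≤ P x) →
      ∫ x, m x * P x ∂g.vol ≤ ∫ x, -(κ x * g.inner x (X x) (g.grad P x)) ∂g.vol)
    (β : ℝ) {w : M → ℝ} (hw : IsTestFunctionOn (n := n) U w) (hw0 : ∀ x, 0 ≤ w x) (c : M)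
    (hwc : tsupport w ⊆ (chartAt (EuclideanSpace ℝ (Fin n)) c).source) :
    ∫ x, m x * (a x * ρ x ^ β * w x) ∂g.vol ≤
      ∫ x, -(κ x * (g.inner x (X x) (A x) * ρ x ^ β * w x +
        a x * (β * ρ x ^ (β - 1) * g.inner x (X x) (X x)) * w x +
        a x * ρ x ^ β * g.inner x (X x) (g.grad w x))) ∂g.vol := by
  set e := chartAt (EuclideanSpace ℝ (Fin n)) c with hedef
  have he : e ∈ atlas (EuclideanSpace ℝ (Fin n)) M := chart_mem_atlas _ c
  set W := e.target ∩ e.symm ⁻¹' U with hWdef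
  have hW : IsOpen W := e.isOpen_inter_preimage_symm hU
  have hcomp : ∀ {f : M → ℝ}, ContinuousOn f U → ContinuousOn (fun z => f (e.symm z)) W :=
    fun hf => hf.comp (e.continuousOn_symm.mono inter_subset_left) fun z hz => hz.2
  have hD : ContinuousOn (g.density e) W := (g.continuousOn_density he).mono inter_subset_left
  set R : Fin n → EuclideanSpace ℝ (Fin n) → ℝ := fun j z => ∑ i, g.inner (e.symm z)
    (X (e.symm z)) (chartVector e z (EuclideanSpace.single i 1)) * (g.gram e z)⁻¹ i j with hR
  -- The components of -√(det g_ij) κ X with raised index: with the volume density included, the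
  -- inequality takes the Euclidean form m ≤ -div Z, to which the mollification argument applies.
  set Z : Fin n → EuclideanSpace ℝ (Fin n) → ℝ := fun j z =>
    -(g.density e z * κ (e.symm z) * R j z) with hZ
  have hZdom : ∀ j, IsDominatedOn volume W (Z j) := fun j =>
    (((hD.mul (hcomp hκ)).isDominatedOn hW.measurableSet).mul
      (isDominatedOn_raised_component hU hX hN hXN c j)).neg
  have hξdom : ∀ j : Fin n, IsDominatedOn volume W (fun z => g.inner (e.symm z) (X (e.symm z))
      (chartVector e z (EuclideanSpace.single j 1))) := fun j =>
    isDominatedOn_component hU hX hN hXN c _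
  obtain ⟨hw1, hw2, hw3⟩ := contDiff_indicator_comp_symm he hw hwc
  set w' := e.target.indicator fun z => w (e.symm z) with hw'
  have hw'd : ∀ z ∈ e.target, ∀ v,
      fderiv ℝ w' z v = fderiv ℝ (fun y => w (e.symm y)) z v := by
    intro z hz v
    have : w' =ᶠ[𝓝 z] fun y => w (e.symm y) := by
      filter_upwards [e.open_target.mem_nhds hz] with y hy
      simp [hw', hy]
    rw [this.fderiv_eq]
  have key := integral_le_of_forall_test_of_weakDeriv
    (fun j : Fin n => (EuclideanSpace.single j 1 : EuclideanSpace ℝ (Fin n))) hW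
    (m := fun z => g.density e z * m (e.symm z)) (hD.mul (hcomp hm)) (Z := Z)
    (fun j => (hZdom j).1) (fun j => (hZdom j).isLocallyEssBoundedOn) ?_
    (a := fun z => a (e.symm z)) (ρ := fun z => ρ (e.symm z)) (fun z => ha0 _) (hA c).1
    (hcomp hρ) (fun z hz => hρ0 _ hz.2)
    (A := fun j z => g.inner (e.symm z) (A (e.symm z))
      (chartVector e z (EuclideanSpace.single j 1)))
    (ξ := fun j z => g.inner (e.symm z) (X (e.symm z))
      (chartVector e z (EuclideanSpace.single j 1)))
    (fun j => ((hA c).2 _).1) (fun j => ((hX c).2 _).1) (fun j => ((hA c).2 _).2)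
    (fun j => ((hX c).2 _).2) (fun j => (hξdom j).isLocallyEssBoundedOn) β hw1 hw2 hw3
    (fun z => indicator_nonneg (fun z _ => hw0 _) z)
  · have hoff : ∀ x, x ∉ e.source → w x = 0 := fun x hx =>
      image_eq_zero_of_notMem_tsupport fun h => hx (hwc h)
    refine (le_of_eq ?_).trans (key.trans (le_of_eq ?_))
    · refine g.integral_eq_integral_chart c (fun x hx => ?_) (fun z hz => ?_) fun z hz => ?_
      · simp [hoff x hx]
      · have h0 : z ∉ e.target := hz
        simp [hw', h0]
      · simp only [← hedef] at hz ⊢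
        simp only [hw', indicator_of_mem hz]
        ring
    · symm
      refine g.integral_eq_integral_chart c (fun x hx => ?_) (fun z hz => ?_) fun z hz => ?_
      · simp [hoff x hx, g.inner_grad_eq_zero (fun h => hx (hwc h))]
      · have h0 : z ∉ tsupport w' := fun h => hz (hw3 h).1
        simp [image_eq_zero_of_notMem_tsupport h0, fderiv_of_notMem_tsupport (𝕜 := ℝ) h0]
      · simp only [← hedef] at hz ⊢
        have h1 : ∀ Y : TangentSpace (𝓡 n) (e.symm z), g.inner (e.symm z) (X (e.symm z)) Y =
            ∑ j, R j z * g.inner (e.symm z) Y (chartVector e z (EuclideanSpace.single j 1)) :=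
          fun Y => g.inner_eq_sum_inv_gram he hz _ Y
        have h2 : g.inner (e.symm z) (X (e.symm z)) (g.grad w (e.symm z)) =
            ∑ j, R j z * fderiv ℝ (fun y => w (e.symm y)) z (EuclideanSpace.single j 1) :=
          g.inner_grad_symm he hz (hw.1.mdifferentiable (by simp) _) _
        rw [h1 (A (e.symm z)), h1 (X (e.symm z)), h2]
        have hwz : w' z = w (e.symm z) := by simp [hw', hz]
        simp only [hw'd z hz, hZ, hwz]
        simp only [Finset.mul_sum, Finset.sum_mul, ← Finset.sum_add_distrib,
          ← Finset.sum_neg_distrib]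
        refine Finset.sum_congr rfl fun j _ => ?_
        ring
  -- The hypothesis of the Euclidean lemma: a coordinate test function is extended by zero to `M`,
  -- where `htest` applies.
  · intro P hP hPc hPW hP0
    obtain ⟨hP1, hP2⟩ := isTestFunctionOn_indicator_comp he hP hPc hPW
    set P' := e.source.indicator fun x => P (e x) with hP'
    have h := htest P' hP1 (fun x => indicator_nonneg (fun x _ => hP0 _) x)
    have hP'z : ∀ z ∈ e.target, P' (e.symm z) = P z := by
      intro z hz
      simp [hP', e.map_target hz, e.right_inv hz]
    refine (le_of_eq ?_).trans (h.trans (le_of_eq ?_))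
    · symm
      refine g.integral_eq_integral_chart c (fun x hx => ?_) (fun z hz => ?_) fun z hz => ?_
      · have h0 : x ∉ e.source := hx
        simp [hP', h0]
      · simp [image_eq_zero_of_notMem_tsupport fun h => hz (hPW h).1]
      · simp only [← hedef] at hz ⊢
        rw [hP'z z hz]
        ring
    · refine g.integral_eq_integral_chart c (fun x hx => ?_) (fun z hz => ?_) fun z hz => ?_
      · simp [g.inner_grad_eq_zero (fun h => hx (hP2 h))]
      · simp [fderiv_of_notMem_tsupport (𝕜 := ℝ) fun h => hz (hPW h).1]
      · simp only [← hedef] at hz ⊢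
        have hev : (fun y => P' (e.symm y)) =ᶠ[𝓝 z] P := by
          filter_upwards [e.open_target.mem_nhds hz] with y hy using hP'z y hy
        rw [g.inner_grad_symm he hz (hP1.1.mdifferentiable (by simp) _), hev.fderiv_eq, mul_neg,
          Finset.mul_sum, Finset.mul_sum, ← Finset.sum_neg_distrib]
        refine Finset.sum_congr rfl fun j _ => ?_
        simp only [hZ, hR]
        ring

theorem integrable_mul_of_isDominatedOn [SecondCountableTopology M] (hU : IsOpen U)
    {f b : M → ℝ} (hf : LocallyIntegrableOn f U g.vol) (hb : IsDominatedOn g.vol U b) {K : Set M}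
    (hK : IsCompact K) (hKU : K ⊆ U) (h0 : ∀ x, x ∉ K → b x = 0) :
    Integrable (fun x => b x * f x) g.vol :=
  (hb.mul_locallyIntegrableOn hU hf).integrable_of_eq_zero hK hKU fun x hx => by simp [h0 x hx]

/-- A distributional inequality `m ≤ div (κ X)` on `U`, where `X = ∇ρ` is a bounded weak
gradient, can be tested with `a ρ ^ β w`, where `a` is in `W^{1,1}_loc` and `w` is a test
function. -/
theorem integral_le_of_forall_test [T2Space M] [SecondCountableTopology M] (hU : IsOpen U)
    (hX : g.IsWeakGradOn U ρ X) (hN : ContinuousOn N U)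
    (hXN : ∀ᵐ x ∂g.vol.restrict U, g.vnorm x (X x) ≤ N x) (hA : g.IsWeakGradOn U a A)
    (ha0 : ∀ x, 0 ≤ a x) (hρ : ContinuousOn ρ U) (hρ0 : ∀ x ∈ U, 0 < ρ x) {m κ : M → ℝ}
    (hm : ContinuousOn m U) (hκ : ContinuousOn κ U)
    (htest : ∀ P : M → ℝ, IsTestFunctionOn (n := n) U P → (∀ x, 0 ≤ P x) →
      ∫ x, m x * P x ∂g.vol ≤ ∫ x, -(κ x * g.inner x (X x) (g.grad P x)) ∂g.vol)
    (β : ℝ) {w : M → ℝ} (hw : IsTestFunctionOn (n := n) U w) (hw0 : ∀ x, 0 ≤ w x) :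
    ∫ x, m x * (a x * ρ x ^ β * w x) ∂g.vol ≤
      ∫ x, -(κ x * (g.inner x (X x) (A x) * ρ x ^ β * w x +
        a x * (β * ρ x ^ (β - 1) * g.inner x (X x) (X x)) * w x +
        a x * ρ x ^ β * g.inner x (X x) (g.grad w x))) ∂g.vol := by
  have : LocallyCompactSpace M :=
    ChartedSpace.locallyCompactSpace (EuclideanSpace ℝ (Fin n)) M
  -- The inequality is linear in `w`, so `w` alone is cut up by a partition of unity subordinate to
  -- the charts. Only finitely many pieces meet its compact support.
  obtain ⟨χ, hχ⟩ := SmoothPartitionOfUnity.exists_isSubordinate_chartAt_source (𝓡 n) M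
  have hfin : {c | ((fun c => tsupport (χ c)) c ∩ tsupport w).Nonempty}.Finite :=
    χ.locallyFinite.closure.finite_nonempty_inter_compact hw.2.1
  set I := hfin.toFinset with hI
  have hsum : ∀ x, ∑ c ∈ I, χ c x * w x = w x := by
    intro x
    by_cases hx : x ∈ tsupport w
    · have h1 := χ.sum_eq_one (mem_univ x)
      rw [finsum_eq_sum_of_support_subset (s := I)] at h1
      · rw [← Finset.sum_mul, h1, one_mul]
      · intro c hc
        rw [hI, Finite.coe_toFinset]
        exact ⟨x, subset_tsupport _ hc, hx⟩
    · simp [image_eq_zero_of_notMem_tsupport hx]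
  have hts : ∀ c, tsupport (fun x => χ c x * w x) ⊆ tsupport w := fun c =>
    tsupport_mul_subset_right
  have htest' : ∀ c, IsTestFunctionOn (n := n) U (fun x => χ c x * w x) := fun c =>
    ⟨(χ c).contMDiff.mul hw.1, hw.2.1.of_isClosed_subset (isClosed_tsupport _) (hts c),
      (hts c).trans hw.2.2⟩
  have hc := fun c => integral_le_of_forall_test_of_tsupport_subset_source hU hX hN hXN hA ha0 hρ
    hρ0 hm hκ htest β (htest' c) (fun x => mul_nonneg (χ.nonneg c x) (hw0 x)) c
    (tsupport_mul_subset_left.trans (hχ c))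
  have hUm := hU.measurableSet
  have hal := locallyIntegrableOn_of_isWeakGradOn hU hA
  have hXA := locallyIntegrableOn_inner hU hX hN hXN hA
  have hXX := isDominatedOn_inner_self hU hX hN hXN
  have hpow : ∀ γ : ℝ, ContinuousOn (fun x => ρ x ^ γ) U := fun γ =>
    hρ.rpow_const fun x hx => Or.inl (hρ0 x hx).ne'
  have hL : ∀ c, Integrable (fun x => m x * (a x * ρ x ^ β * (χ c x * w x))) g.vol := by
    intro c
    refine (integrable_mul_of_isDominatedOn hU hal (b := fun x => m x * ρ x ^ β * (χ c x * w x))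
      (((hm.mul (hpow β)).mul (htest' c).1.continuous.continuousOn).isDominatedOn hUm)
      hw.2.1 hw.2.2 fun x hx => by simp [image_eq_zero_of_notMem_tsupport hx]).congr
        (Eventually.of_forall fun x => ?_)
    simp only
    ring
  have hR : ∀ c, Integrable (fun x => -(κ x * (g.inner x (X x) (A x) * ρ x ^ β * (χ c x * w x) +
        a x * (β * ρ x ^ (β - 1) * g.inner x (X x) (X x)) * (χ c x * w x) +
        a x * ρ x ^ β * g.inner x (X x) (g.grad (fun x => χ c x * w x) x)))) g.vol := by
    intro c
    have hχw := (htest' c).1.continuous.continuousOn (s := U)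
    have i1 := integrable_mul_of_isDominatedOn hU hXA
      (b := fun x => κ x * ρ x ^ β * (χ c x * w x))
      (((hκ.mul (hpow β)).mul hχw).isDominatedOn hUm)
      hw.2.1 hw.2.2 fun x hx => by simp [image_eq_zero_of_notMem_tsupport hx]
    have i2 := integrable_mul_of_isDominatedOn hU hal
      (b := fun x => κ x * (β * ρ x ^ (β - 1)) * (χ c x * w x) * g.inner x (X x) (X x))
      ((((hκ.mul ((hpow (β - 1)).const_mul β)).mul hχw).isDominatedOn hUm).mul hXX)
      hw.2.1 hw.2.2 fun x hx => by simp [image_eq_zero_of_notMem_tsupport hx]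
    have i3 := integrable_mul_of_isDominatedOn hU hal
      (b := fun x => κ x * ρ x ^ β * g.inner x (X x) (g.grad (fun x => χ c x * w x) x))
      (((hκ.mul (hpow β)).isDominatedOn hUm).mul
        (isDominatedOn_inner_grad hU hX hN hXN (htest' c).1))
      hw.2.1 hw.2.2 fun x hx => by simp [g.inner_grad_eq_zero fun h => hx (hts c h)]
    refine ((i1.add i2).add i3).neg.congr (Eventually.of_forall fun x => ?_)
    simp only [Pi.neg_apply, Pi.add_apply]
    ring
  have hfinal := Finset.sum_le_sum fun c (_ : c ∈ I) => hc c
  rw [← integral_finsetSum _ fun c _ => hL c, ← integral_finsetSum _ fun c _ => hR c] at hfinal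
  refine (le_of_eq ?_).trans (hfinal.trans (le_of_eq ?_))
  · refine integral_congr_ae (Eventually.of_forall fun x => ?_)
    simp only
    rw [← Finset.mul_sum, ← Finset.mul_sum, hsum]
  · refine integral_congr_ae (Eventually.of_forall fun x => ?_)
    -- The gradients of the cutoffs cancel in the sum, since the pieces add up to `w` identically.
    have hg : g.inner x (X x) (g.grad w x) =
        ∑ c ∈ I, g.inner x (X x) (g.grad (fun x => χ c x * w x) x) := by
      rw [← (g.inner_grad_sum I (fun c => (htest' c).1.mdifferentiable (by simp) x) (X x)).2]
      congr 2
      ext y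
      exact (hsum y).symm
    simp only
    rw [hg, Finset.sum_neg_distrib, ← Finset.mul_sum, Finset.sum_add_distrib,
      Finset.sum_add_distrib, ← Finset.mul_sum, ← Finset.mul_sum, ← Finset.mul_sum, hsum]

end SmoothMetric

/-! ### Young's inequality and the regularization of |t|^p. -/

section RealInequalities

/-- Young's inequality with a parameter. -/
theorem mul_rpow_sub_one_mul_le {p k y r : ℝ} (hp : 1 < p) (hk : 0 < k) (hy : 0 ≤ y)
    (hr : 0 ≤ r) : p * (y ^ (p - 1) * r) ≤ (p - 1) * k * y ^ p + k ^ (1 - p) * r ^ p := by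
  have hp0 : 0 < p := by linarith
  rcases hy.eq_or_lt with rfl | hy
  · rw [Real.zero_rpow (by linarith), Real.zero_rpow (by linarith)]
    simp only [zero_mul, mul_zero, zero_add]
    positivity
  -- Bernoulli's inequality at s = r/(ky) - 1, to be multiplied by k y^p; equality holds when r =
  -- ky.
  · have h := one_add_mul_self_le_rpow_one_add (s := r / (k * y) - 1) (p := p)
      (by linarith [div_nonneg hr (mul_pos hk hy).le]) hp.le
    rw [add_sub_cancel, Real.div_rpow hr (mul_pos hk hy).le, Real.mul_rpow hk.le hy.le] at h
    have hyp : 0 < y ^ p := Real.rpow_pos_of_pos hy p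
    have hkp : 0 < k ^ p := Real.rpow_pos_of_pos hk p
    have h2 := mul_le_mul_of_nonneg_left h (mul_pos hk hyp).le
    rw [Real.rpow_sub hy, Real.rpow_sub hk, Real.rpow_one, Real.rpow_one]
    have e1 : k * y ^ p * (1 + p * (r / (k * y) - 1)) =
        p * (y ^ p / y * r) - (p - 1) * k * y ^ p := by
      field_simp
      ring
    have e2 : k * y ^ p * (r ^ p / (k ^ p * y ^ p)) = k / k ^ p * r ^ p := by
      field_simp
    rw [e1, e2] at h2
    linarith

/-- A smooth approximation of `|t| ^ p`. -/
def smoothAbsRpow (p ε t : ℝ) : ℝ := (t ^ 2 + ε) ^ (p / 2) - ε ^ (p / 2)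

theorem smoothAbsRpow_zero (p ε : ℝ) : smoothAbsRpow p ε 0 = 0 := by simp [smoothAbsRpow]

theorem smoothAbsRpow_nonneg {p ε : ℝ} (hp : 0 ≤ p) (hε : 0 ≤ ε) (t : ℝ) :
    0 ≤ smoothAbsRpow p ε t :=
  sub_nonneg.2 (Real.rpow_le_rpow hε (by nlinarith) (by linarith))

theorem contDiff_smoothAbsRpow (p : ℝ) {ε : ℝ} (hε : 0 < ε) : ContDiff ℝ ∞ (smoothAbsRpow p ε) := by
  refine ContDiff.sub (ContDiff.rpow_const_of_ne (by fun_prop) fun t => ?_) contDiff_const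
  positivity

theorem hasDerivAt_smoothAbsRpow (p : ℝ) {ε : ℝ} (hε : 0 < ε) (t : ℝ) :
    HasDerivAt (smoothAbsRpow p ε) (p * t * (t ^ 2 + ε) ^ (p / 2 - 1)) t := by
  have h1 : HasDerivAt (fun t : ℝ => t ^ 2 + ε) (2 * t) t := by
    simpa using (hasDerivAt_pow 2 t).add_const ε
  have h2 := (h1.rpow_const (p := p / 2) (Or.inl (by positivity))).sub_const (ε ^ (p / 2))
  exact h2.congr_deriv (by ring)

/-- Since |t| ≤ (t² + ε)^{1/2}, the factor t is absorbed. The exponent (p-1)/2 is nonnegative in the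
case p > 1, so this bound remains controlled and tends to p|t|^{p-1} as ε → 0. -/
theorem abs_deriv_smoothAbsRpow_le {p ε : ℝ} (hp : 0 ≤ p) (hε : 0 < ε) (t : ℝ) :
    |p * t * (t ^ 2 + ε) ^ (p / 2 - 1)| ≤ p * (t ^ 2 + ε) ^ ((p - 1) / 2) := by
  have hpos : 0 < t ^ 2 + ε := by positivity
  rw [abs_mul, abs_mul, abs_of_nonneg hp, abs_of_pos (Real.rpow_pos_of_pos hpos _), mul_assoc]
  refine mul_le_mul_of_nonneg_left ?_ hp
  have h : |t| ≤ (t ^ 2 + ε) ^ (1 / 2 : ℝ) := by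
    rw [← Real.sqrt_eq_rpow]
    exact Real.abs_le_sqrt (by linarith)
  calc |t| * (t ^ 2 + ε) ^ (p / 2 - 1)
      ≤ (t ^ 2 + ε) ^ (1 / 2 : ℝ) * (t ^ 2 + ε) ^ (p / 2 - 1) :=
        mul_le_mul_of_nonneg_right h (Real.rpow_nonneg hpos.le _)
    _ = (t ^ 2 + ε) ^ ((p - 1) / 2) := by
        rw [← Real.rpow_add hpos]
        congr 1
        ring

theorem sq_rpow_half (t q : ℝ) : (t ^ 2) ^ (q / 2) = |t| ^ q := by
  rw [← sq_abs, ← Real.rpow_natCast, ← Real.rpow_mul (abs_nonneg t)]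
  congr 1
  push_cast
  ring

theorem tendsto_sq_add_rpow {ε : ℕ → ℝ} (hε : Tendsto ε atTop (𝓝 0)) {q : ℝ} (hq : 0 ≤ q)
    (t : ℝ) : Tendsto (fun k => (t ^ 2 + ε k) ^ (q / 2)) atTop (𝓝 (|t| ^ q)) := by
  rw [← sq_rpow_half]
  have h : Tendsto (fun k => t ^ 2 + ε k) atTop (𝓝 (t ^ 2)) := by
    simpa using hε.const_add (t ^ 2)
  exact h.rpow_const (Or.inr (by linarith))

theorem tendsto_smoothAbsRpow {ε : ℕ → ℝ} (hε : Tendsto ε atTop (𝓝 0)) {p : ℝ} (hp : 0 < p)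
    (t : ℝ) : Tendsto (fun k => smoothAbsRpow p (ε k) t) atTop (𝓝 (|t| ^ p)) := by
  have h := (tendsto_sq_add_rpow hε hp.le t).sub (hε.rpow_const (p := p / 2)
    (Or.inr (by linarith)))
  rwa [Real.zero_rpow (by linarith), sub_zero] at h

end RealInequalities

/-- The integrals of `f G_k` converge if `f` is integrable and the `G_k` are uniformly bounded and
converge almost everywhere. -/
theorem tendsto_integral_mul_of_bounded {α : Type*} [MeasurableSpace α] {μ : Measure α}
    {G : ℕ → α → ℝ} {f g : α → ℝ} {B : ℝ} (hf : Integrable f μ)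
    (hG : ∀ k, AEStronglyMeasurable (G k) μ) (hGB : ∀ k, ∀ᵐ x ∂μ, |G k x| ≤ B)
    (hGg : ∀ᵐ x ∂μ, Tendsto (fun k => G k x) atTop (𝓝 (g x))) :
    Tendsto (fun k => ∫ x, f x * G k x ∂μ) atTop (𝓝 (∫ x, f x * g x ∂μ)) :=
  (tendsto_integral_mul_of_tendsto_L1_of_bounded (fun _ => hf) hf (by simp) hG hGB hGg).2.2

/-! ### The weighted Hardy inequality. -/

namespace SmoothMetric

variable {n : ℕ} {M : Type*} [TopologicalSpace M]
  [ChartedSpace (EuclideanSpace ℝ (Fin n)) M] [IsManifold (𝓡 n) ∞ M] [MeasurableSpace M]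
  [BorelSpace M] {g : SmoothMetric n M} {U : Set M}
  {X A : (x : M) → TangentSpace (𝓡 n) x} {ρ a N : M → ℝ}

/-- The weak inequality `C / ρ ≤ div (θ σ ∇ρ) / σ`, tested with `a ρ ^ (α + 1) w`. -/
theorem integral_le_of_laplacian_lower_bound [T2Space M] [SecondCountableTopology M]
    (hU : IsOpen U)
    (hX : g.IsWeakGradOn U ρ X) (hN : ContinuousOn N U)
    (hXN : ∀ᵐ x ∂g.vol.restrict U, g.vnorm x (X x) ≤ N x) (hA : g.IsWeakGradOn U a A)
    (ha0 : ∀ x, 0 ≤ a x) (hρ : ContinuousOn ρ U) (hρ0 : ∀ x ∈ U, 0 < ρ x) {θ σ : M → ℝ}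
    (hθ : Continuous θ) (hσ : Continuous σ)
    (hXX : ∀ᵐ x ∂g.vol.restrict U, θ x * g.inner x (X x) (X x) = 1) {C : ℝ}
    (htest : ∀ P : M → ℝ, IsTestFunctionOn (n := n) U P → (∀ x, 0 ≤ P x) →
      ∫ x, C / ρ x * σ x * P x ∂g.vol ≤
        ∫ x, -(θ x * σ x * g.inner x (X x) (g.grad P x)) ∂g.vol)
    (α : ℝ) {w : M → ℝ} (hw : IsTestFunctionOn (n := n) U w) (hw0 : ∀ x, 0 ≤ w x) :
    (C + α + 1) * (∫ x, a x * ρ x ^ α * σ x * w x ∂g.vol) +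
        ∫ x, g.inner x (X x) (A x) * (ρ x ^ (α + 1) * θ x * σ x * w x) ∂g.vol ≤
      ∫ x, -(a x * ρ x ^ (α + 1) * σ x * (θ x * g.inner x (X x) (g.grad w x))) ∂g.vol := by
  have hUm := hU.measurableSet
  have hpow : ∀ γ : ℝ, ContinuousOn (fun x => ρ x ^ γ) U := fun γ =>
    hρ.rpow_const fun x hx => Or.inl (hρ0 x hx).ne'
  have hwc := hw.1.continuous.continuousOn (s := U)
  have hw_off : ∀ x, x ∉ tsupport w → w x = 0 := fun x hx => image_eq_zero_of_notMem_tsupport hx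
  have hal := locallyIntegrableOn_of_isWeakGradOn hU hA
  have h := integral_le_of_forall_test hU hX hN hXN hA ha0 hρ hρ0
    (m := fun x => C / ρ x * σ x) (κ := fun x => θ x * σ x)
    ((continuousOn_const.div hρ fun x hx => (hρ0 x hx).ne').mul hσ.continuousOn)
    (hθ.mul hσ).continuousOn htest (α + 1) hw hw0
  have i1 : Integrable (fun x => a x * ρ x ^ α * σ x * w x) g.vol :=
    (integrable_mul_of_isDominatedOn hU hal (b := fun x => ρ x ^ α * σ x * w x)
      ((((hpow α).mul hσ.continuousOn).mul hwc).isDominatedOn hUm) hw.2.1 hw.2.2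
      fun x hx => by simp [hw_off x hx]).congr (Eventually.of_forall fun x => by
        simp only; ring)
  have i2 : Integrable (fun x => g.inner x (X x) (A x) * (ρ x ^ (α + 1) * θ x * σ x * w x))
      g.vol :=
    (integrable_mul_of_isDominatedOn hU (locallyIntegrableOn_inner hU hX hN hXN hA)
      (b := fun x => ρ x ^ (α + 1) * θ x * σ x * w x)
      (((((hpow (α + 1)).mul hθ.continuousOn).mul hσ.continuousOn).mul hwc).isDominatedOn hUm)
      hw.2.1 hw.2.2 fun x hx => by simp [hw_off x hx]).congr (Eventually.of_forall fun x => by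
        simp only; ring)
  have i3 : Integrable (fun x => a x * ρ x ^ (α + 1) * σ x *
      (θ x * g.inner x (X x) (g.grad w x))) g.vol :=
    (integrable_mul_of_isDominatedOn hU hal
      (b := fun x => ρ x ^ (α + 1) * σ x * θ x * g.inner x (X x) (g.grad w x))
      (((((hpow (α + 1)).mul hσ.continuousOn).mul hθ.continuousOn).isDominatedOn hUm).mul
        (isDominatedOn_inner_grad hU hX hN hXN hw.1))
      hw.2.1 hw.2.2 fun x hx => by simp [g.inner_grad_eq_zero hx]).congr
        (Eventually.of_forall fun x => by simp only; ring)
  have hoff : ∀ x, x ∉ U → w x = 0 ∧ g.inner x (X x) (g.grad w x) = 0 := fun x hx =>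
    ⟨hw_off x fun h => hx (hw.2.2 h), g.inner_grad_eq_zero (fun h => hx (hw.2.2 h)) _⟩
  -- One power of ρ cancels on `U`. Elsewhere ρ need not be positive, but `w` vanishes.
  have e1 : ∫ x, C / ρ x * σ x * (a x * ρ x ^ (α + 1) * w x) ∂g.vol =
      C * ∫ x, a x * ρ x ^ α * σ x * w x ∂g.vol := by
    rw [← integral_const_mul]
    refine integral_congr_ae (Eventually.of_forall fun x => ?_)
    by_cases hx : x ∈ U
    · have := (hρ0 x hx).ne'
      simp only
      rw [Real.rpow_add (hρ0 x hx), Real.rpow_one]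
      field_simp
    · simp [(hoff x hx).1]
  -- The eikonal equation `hXX` turns the derivative of ρ^{α+1} into (α+1)aρ^α σw, which joins the
  -- term with C on the left.
  have e2 : ∫ x, -(θ x * σ x * (g.inner x (X x) (A x) * ρ x ^ (α + 1) * w x +
        a x * ((α + 1) * ρ x ^ (α + 1 - 1) * g.inner x (X x) (X x)) * w x +
        a x * ρ x ^ (α + 1) * g.inner x (X x) (g.grad w x))) ∂g.vol =
      ∫ x, (-(a x * ρ x ^ (α + 1) * σ x * (θ x * g.inner x (X x) (g.grad w x))) -
        (g.inner x (X x) (A x) * (ρ x ^ (α + 1) * θ x * σ x * w x) +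
          (α + 1) * (a x * ρ x ^ α * σ x * w x))) ∂g.vol := by
    refine integral_congr_ae ?_
    rw [Filter.EventuallyEq]
    rw [ae_restrict_iff' hUm] at hXX
    filter_upwards [hXX] with x hxx
    by_cases hx : x ∈ U
    · rw [add_sub_cancel_right]
      linear_combination (-(σ x * a x * (α + 1) * ρ x ^ α * w x)) * hxx hx
    · simp [(hoff x hx).1, (hoff x hx).2]
  have i4 : Integrable (fun x => g.inner x (X x) (A x) * (ρ x ^ (α + 1) * θ x * σ x * w x) +
      (α + 1) * (a x * ρ x ^ α * σ x * w x)) g.vol := i2.add (i1.const_mul (α + 1))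
  have i5 : Integrable (fun x => -(a x * ρ x ^ (α + 1) * σ x *
      (θ x * g.inner x (X x) (g.grad w x)))) g.vol := i3.neg
  rw [e1, e2, integral_sub i5 i4, integral_add i2 (i1.const_mul (α + 1)),
    integral_const_mul] at h
  linarith

end SmoothMetric

namespace SmoothMetric

variable {n : ℕ} {M : Type*} [TopologicalSpace M]
  [ChartedSpace (EuclideanSpace ℝ (Fin n)) M] [IsManifold (𝓡 n) ∞ M] [MeasurableSpace M]
  [BorelSpace M] {g : SmoothMetric n M} {U : Set M}
  {X A : (x : M) → TangentSpace (𝓡 n) x} {ρ a N : M → ℝ}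

theorem IsTestFunctionOn.comp_smoothAbsRpow {φ : M → ℝ} (hφ : IsTestFunctionOn (n := n) U φ)
    (p : ℝ) {ε : ℝ} (hε : 0 < ε) :
    IsTestFunctionOn (n := n) U (fun x => smoothAbsRpow p ε (φ x)) ∧
      tsupport (fun x => smoothAbsRpow p ε (φ x)) ⊆ tsupport φ := by
  have hts : tsupport (fun x => smoothAbsRpow p ε (φ x)) ⊆ tsupport φ :=
    closure_mono fun x hx h => hx (by simp [h, smoothAbsRpow_zero])
  exact ⟨⟨(contDiff_smoothAbsRpow p hε).contMDiff.comp hφ.1,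
    hφ.2.1.of_isClosed_subset (isClosed_tsupport _) hts, hts.trans hφ.2.2⟩, hts⟩

/-- The weighted Hardy inequality with remainder, for a function `ρ` with `θ |∇ρ|² = 1` which
satisfies `C / ρ ≤ div (θ σ ∇ρ) / σ` weakly. -/
theorem hardy_inequality [T2Space M] [SecondCountableTopology M] (hU : IsOpen U)
    (hX : g.IsWeakGradOn U ρ X) (hN : ContinuousOn N U)
    (hXN : ∀ᵐ x ∂g.vol.restrict U, g.vnorm x (X x) ≤ N x) (hA : g.IsWeakGradOn U a A)
    (ha0 : ∀ x, 0 ≤ a x) (hρ : ContinuousOn ρ U) (hρ0 : ∀ x ∈ U, 0 < ρ x) {θ σ : M → ℝ}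
    (hθ : Continuous θ) (hσ : Continuous σ) (hσ0 : ∀ x, 0 ≤ σ x)
    (hXX : ∀ᵐ x ∂g.vol.restrict U, θ x * g.inner x (X x) (X x) = 1) {C α p : ℝ}
    (hC : 0 < C + α + 1) (hp : 1 < p)
    (htest : ∀ P : M → ℝ, IsTestFunctionOn (n := n) U P → (∀ x, 0 ≤ P x) →
      ∫ x, C / ρ x * σ x * P x ∂g.vol ≤
        ∫ x, -(θ x * σ x * g.inner x (X x) (g.grad P x)) ∂g.vol)
    {φ : M → ℝ} (hφ : IsTestFunctionOn (n := n) U φ) :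
    Integrable (fun x => a x * ρ x ^ (α + p) * |θ x * g.inner x (X x) (g.grad φ x)| ^ p * σ x)
      g.vol ∧
    Integrable (fun x => a x * ρ x ^ α * |φ x| ^ p * σ x) g.vol ∧
    Integrable (fun x => ρ x ^ (α + 1) * |φ x| ^ p * (θ x * g.inner x (X x) (A x)) * σ x) g.vol ∧
    ((C + α + 1) / p) ^ p * (∫ x, a x * ρ x ^ α * |φ x| ^ p * σ x ∂g.vol) +
      ((C + α + 1) / p) ^ (p - 1) *
        (∫ x, ρ x ^ (α + 1) * |φ x| ^ p * (θ x * g.inner x (X x) (A x)) * σ x ∂g.vol) ≤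
    ∫ x, a x * ρ x ^ (α + p) * |θ x * g.inner x (X x) (g.grad φ x)| ^ p * σ x ∂g.vol := by
  have hp0 : 0 < p := by linarith
  have hUm := hU.measurableSet
  set K := tsupport φ with hKdef
  have hKc : IsCompact K := hφ.2.1
  have hKU : K ⊆ U := hφ.2.2
  have hKm : MeasurableSet K := (isClosed_tsupport φ).measurableSet
  have hpow : ∀ γ : ℝ, ContinuousOn (fun x => ρ x ^ γ) U := fun γ =>
    hρ.rpow_const fun x hx => Or.inl (hρ0 x hx).ne'
  have hal := locallyIntegrableOn_of_isWeakGradOn hU hA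
  have hXA := locallyIntegrableOn_inner hU hX hN hXN hA
  have hφ_off : ∀ x, x ∉ K → φ x = 0 := fun x hx => image_eq_zero_of_notMem_tsupport hx
  have habs : ∀ q : ℝ, 0 ≤ q → Continuous fun x => |φ x| ^ q := fun q hq =>
    hφ.1.continuous.abs.rpow_const fun _ => Or.inr hq
  set s : M → ℝ := fun x => θ x * g.inner x (X x) (g.grad φ x) with hs
  have hs_off : ∀ x, x ∉ K → s x = 0 := fun x hx => by simp [hs, g.inner_grad_eq_zero hx]
  have hsdom : IsDominatedOn g.vol U s :=
    (hθ.continuousOn.isDominatedOn hUm).mul (isDominatedOn_inner_grad hU hX hN hXN hφ.1)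
  have hsdom' : IsDominatedOn g.vol U fun x => |s x| := by
    simpa using hsdom.rpow_abs zero_le_one
  have iR : Integrable (fun x => a x * ρ x ^ (α + p) * |s x| ^ p * σ x) g.vol :=
    (integrable_mul_of_isDominatedOn hU hal (b := fun x => ρ x ^ (α + p) * σ x * |s x| ^ p)
      ((((hpow (α + p)).mul hσ.continuousOn).isDominatedOn hUm).mul (hsdom.rpow_abs hp0.le))
      hKc hKU fun x hx => by simp [hs_off x hx, Real.zero_rpow hp0.ne']).congr
        (Eventually.of_forall fun x => by simp only; ring)
  have i1 : Integrable (fun x => a x * ρ x ^ α * |φ x| ^ p * σ x) g.vol :=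
    (integrable_mul_of_isDominatedOn hU hal (b := fun x => ρ x ^ α * |φ x| ^ p * σ x)
      ((((hpow α).mul (habs p hp0.le).continuousOn).mul hσ.continuousOn).isDominatedOn hUm)
      hKc hKU fun x hx => by simp [hφ_off x hx, Real.zero_rpow hp0.ne']).congr
        (Eventually.of_forall fun x => by simp only; ring)
  have i2 : Integrable
      (fun x => ρ x ^ (α + 1) * |φ x| ^ p * (θ x * g.inner x (X x) (A x)) * σ x) g.vol :=
    (integrable_mul_of_isDominatedOn hU hXA
      (b := fun x => ρ x ^ (α + 1) * |φ x| ^ p * θ x * σ x)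
      (((((hpow (α + 1)).mul (habs p hp0.le).continuousOn).mul hθ.continuousOn).mul
        hσ.continuousOn).isDominatedOn hUm)
      hKc hKU fun x hx => by simp [hφ_off x hx, Real.zero_rpow hp0.ne']).congr
        (Eventually.of_forall fun x => by simp only; ring)
  have i3 : Integrable (fun x => p * (a x * ρ x ^ (α + 1) * σ x * |s x|)) g.vol :=
    (integrable_mul_of_isDominatedOn hU hal
      (b := fun x => p * (ρ x ^ (α + 1) * σ x) * |s x|)
      (((((hpow (α + 1)).mul hσ.continuousOn).const_mul p).isDominatedOn hUm).mul hsdom')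
      hKc hKU fun x hx => by simp [hs_off x hx]).congr
        (Eventually.of_forall fun x => by simp only; ring)
  refine ⟨iR, i1, i2, ?_⟩
  -- the inequality for smooth approximations of `|φ| ^ p`, and its limit
  set ε : ℕ → ℝ := fun k => 1 / ((k : ℝ) + 1) with hε
  have hε0 : ∀ k, 0 < ε k := fun k => by positivity
  have hε1 : ∀ k, ε k ≤ 1 := fun k => by
    rw [hε, div_le_one (by positivity)]
    linarith [(Nat.cast_nonneg k : (0 : ℝ) ≤ k)]
  have hεlim : Tendsto ε atTop (𝓝 0) := tendsto_one_div_add_atTop_nhds_zero_nat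
  set w : ℕ → M → ℝ := fun k x => smoothAbsRpow p (ε k) (φ x) with hw
  obtain ⟨B, hB⟩ := hφ.2.1.exists_bound_of_continuous hφ.1.continuous
  have hφB : ∀ x, φ x ^ 2 ≤ B ^ 2 := fun x => by
    rw [← sq_abs]; exact pow_le_pow_left₀ (abs_nonneg _) (hB x) 2
  have hGle : ∀ q : ℝ, 0 ≤ q → ∀ k x, (φ x ^ 2 + ε k) ^ q ≤ (B ^ 2 + 1) ^ q := fun q hq k x =>
    Real.rpow_le_rpow (by have := hε0 k; positivity) (by linarith [hφB x, hε1 k]) hq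
  -- Passing to the absolute value on the right replaces the derivative of the regularized power by
  -- its bound, which has a limit as ε → 0.
  have hineq : ∀ k, (C + α + 1) * (∫ x, a x * ρ x ^ α * σ x * w k x ∂g.vol) +
      ∫ x, g.inner x (X x) (A x) * (ρ x ^ (α + 1) * θ x * σ x * w k x) ∂g.vol ≤
      ∫ x, p * (a x * ρ x ^ (α + 1) * σ x * |s x|) * (φ x ^ 2 + ε k) ^ ((p - 1) / 2) ∂g.vol := by
    intro k
    obtain ⟨ht, hts⟩ := hφ.comp_smoothAbsRpow p (hε0 k)
    refine (integral_le_of_laplacian_lower_bound hU hX hN hXN hA ha0 hρ hρ0 hθ hσ hXX htest α ht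
      fun x => smoothAbsRpow_nonneg hp0.le (hε0 k).le _).trans ((Real.le_norm_self _).trans
        (norm_integral_le_of_norm_le ?_ (Eventually.of_forall fun x => ?_)))
    · have hGc : Continuous fun x => (φ x ^ 2 + ε k) ^ ((p - 1) / 2) :=
        ((hφ.1.continuous.pow 2).add continuous_const).rpow_const fun _ =>
          Or.inr (by linarith)
      refine Integrable.mul_bdd (c := (B ^ 2 + 1) ^ ((p - 1) / 2)) i3
        hGc.aestronglyMeasurable (Eventually.of_forall fun x => ?_)
      have := hε0 k
      rw [Real.norm_of_nonneg (by positivity)]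
      exact hGle _ (by linarith) k x
    · by_cases hx : x ∈ U
      · rw [g.inner_grad_comp (hasDerivAt_smoothAbsRpow p (hε0 k) (φ x))
          (hφ.1.mdifferentiable (by simp) x), norm_neg, norm_mul, Real.norm_of_nonneg
          (mul_nonneg (mul_nonneg (ha0 x) (Real.rpow_nonneg (hρ0 x hx).le _)) (hσ0 x))]
        have h1 : ‖θ x * (p * φ x * (φ x ^ 2 + ε k) ^ (p / 2 - 1) *
            g.inner x (X x) (g.grad φ x))‖ ≤
            p * (φ x ^ 2 + ε k) ^ ((p - 1) / 2) * |s x| := by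
          rw [Real.norm_eq_abs, mul_left_comm, abs_mul]
          exact mul_le_mul_of_nonneg_right (abs_deriv_smoothAbsRpow_le hp0.le (hε0 k) _)
            (abs_nonneg _)
        refine (mul_le_mul_of_nonneg_left h1 (mul_nonneg (mul_nonneg (ha0 x)
          (Real.rpow_nonneg (hρ0 x hx).le _)) (hσ0 x))).trans (le_of_eq ?_)
        ring
      · have h2 : x ∉ K := fun h => hx (hKU h)
        simp [hs_off x h2, g.inner_grad_eq_zero fun h => h2 (hts h)]
  have hwle : ∀ k x, |w k x| ≤ (B ^ 2 + 1) ^ (p / 2) := fun k x => by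
    rw [abs_of_nonneg (smoothAbsRpow_nonneg hp0.le (hε0 k).le _)]
    exact (sub_le_self _ (Real.rpow_nonneg (hε0 k).le _)).trans (hGle _ (by linarith) k x)
  have hwm : ∀ k, Continuous (w k) := fun k =>
    (contDiff_smoothAbsRpow p (hε0 k)).continuous.comp hφ.1.continuous
  have hw_off : ∀ k x, x ∉ K → w k x = 0 := fun k x hx => by
    simp [hw, hφ_off x hx, smoothAbsRpow_zero]
  have hp_off : ∀ x, x ∉ K → |φ x| ^ p = 0 := fun x hx => by
    simp [hφ_off x hx, Real.zero_rpow hp0.ne']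
  have l1 : Tendsto (fun k => ∫ x, a x * ρ x ^ α * σ x * w k x ∂g.vol) atTop
      (𝓝 (∫ x, a x * ρ x ^ α * σ x * |φ x| ^ p ∂g.vol)) := by
    -- The weight without φ is only locally integrable, so the limit is taken over `K`, outside
    -- which both `w k` and |φ|^p vanish.
    have hf : IntegrableOn (fun x => a x * ρ x ^ α * σ x) K g.vol :=
      ((((hpow α).mul hσ.continuousOn).isDominatedOn hUm).mul_locallyIntegrableOn hU
        hal).integrableOn_compact_subset hKU hKc |>.congr
          (Eventually.of_forall fun x => by simp only [Pi.mul_apply]; ring)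
    have h := tendsto_integral_mul_of_bounded hf (G := w) (g := fun x => |φ x| ^ p)
      (fun k => (hwm k).aestronglyMeasurable) (fun k => Eventually.of_forall (hwle k))
      (Eventually.of_forall fun x => tendsto_smoothAbsRpow hεlim hp0 (φ x))
    rw [setIntegral_eq_integral_of_forall_compl_eq_zero
      fun x hx => by simp [hp_off x hx]] at h
    refine h.congr fun k => ?_
    exact setIntegral_eq_integral_of_forall_compl_eq_zero fun x hx => by simp [hw_off k x hx]
  have l2 : Tendsto (fun k => ∫ x, g.inner x (X x) (A x) *
      (ρ x ^ (α + 1) * θ x * σ x * w k x) ∂g.vol) atTop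
      (𝓝 (∫ x, g.inner x (X x) (A x) * (ρ x ^ (α + 1) * θ x * σ x * |φ x| ^ p) ∂g.vol)) := by
    have hf : IntegrableOn (fun x => g.inner x (X x) (A x) * (ρ x ^ (α + 1) * θ x * σ x))
        K g.vol :=
      (((((hpow (α + 1)).mul hθ.continuousOn).mul hσ.continuousOn).isDominatedOn
        hUm).mul_locallyIntegrableOn hU hXA).integrableOn_compact_subset hKU hKc |>.congr
          (Eventually.of_forall fun x => by simp only [Pi.mul_apply]; ring)
    have h := tendsto_integral_mul_of_bounded hf (G := w) (g := fun x => |φ x| ^ p)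
      (fun k => (hwm k).aestronglyMeasurable) (fun k => Eventually.of_forall (hwle k))
      (Eventually.of_forall fun x => tendsto_smoothAbsRpow hεlim hp0 (φ x))
    simp only [mul_assoc] at h ⊢
    rw [setIntegral_eq_integral_of_forall_compl_eq_zero
      fun x hx => by simp [hp_off x hx]] at h
    refine h.congr fun k => ?_
    exact setIntegral_eq_integral_of_forall_compl_eq_zero fun x hx => by simp [hw_off k x hx]
  have l3 : Tendsto (fun k => ∫ x, p * (a x * ρ x ^ (α + 1) * σ x * |s x|) *
      (φ x ^ 2 + ε k) ^ ((p - 1) / 2) ∂g.vol) atTop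
      (𝓝 (∫ x, p * (a x * ρ x ^ (α + 1) * σ x * |s x|) * |φ x| ^ (p - 1) ∂g.vol)) := by
    refine tendsto_integral_mul_of_bounded (B := (B ^ 2 + 1) ^ ((p - 1) / 2)) i3 (fun k => ?_)
      (fun k => Eventually.of_forall fun x => ?_)
      (Eventually.of_forall fun x => tendsto_sq_add_rpow hεlim (by linarith) (φ x))
    · exact (((hφ.1.continuous.pow 2).add continuous_const).rpow_const fun _ =>
        Or.inr (by linarith)).aestronglyMeasurable
    · have := hε0 k
      rw [abs_of_nonneg (by positivity)]
      exact hGle _ (by linarith) k x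
  have hlim := le_of_tendsto_of_tendsto' ((l1.const_mul (C + α + 1)).add l2) l3 hineq
  -- Young's inequality
  set k := (C + α + 1) / p with hk
  have hk0 : 0 < k := div_pos hC hp0
  -- Among parameters κ in Young's inequality, the resulting constant (pk - (p-1)κ)κ^{p-1} is
  -- largest at κ = k.
  have hCk : C + α + 1 = p * k := by rw [hk]; field_simp
  have hY : ∫ x, p * (a x * ρ x ^ (α + 1) * σ x * |s x|) * |φ x| ^ (p - 1) ∂g.vol ≤
      ∫ x, ((p - 1) * k * (a x * ρ x ^ α * |φ x| ^ p * σ x) +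
        k ^ (1 - p) * (a x * ρ x ^ (α + p) * |s x| ^ p * σ x)) ∂g.vol := by
    have iY : Integrable (fun x => (p - 1) * k * (a x * ρ x ^ α * |φ x| ^ p * σ x) +
        k ^ (1 - p) * (a x * ρ x ^ (α + p) * |s x| ^ p * σ x)) g.vol :=
      (i1.const_mul _).add (iR.const_mul _)
    refine (Real.le_norm_self _).trans (norm_integral_le_of_norm_le iY (Eventually.of_forall fun x => ?_))
    by_cases hx : x ∈ U
    · have hρx := hρ0 x hx
      have hnn : 0 ≤ p * (a x * ρ x ^ (α + 1) * σ x * |s x|) * |φ x| ^ (p - 1) := by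
        have := ha0 x; have := hσ0 x; positivity
      rw [Real.norm_of_nonneg hnn]
      -- Young's inequality with y = |φ| and r = ρ|s|, weighted by aρ^α σ: the factor ρ^p from r^p
      -- produces the exponent α + p.
      have hy := mul_rpow_sub_one_mul_le hp hk0 (abs_nonneg (φ x))
        (mul_nonneg hρx.le (abs_nonneg (s x)))
      have hnn2 : 0 ≤ a x * ρ x ^ α * σ x :=
        mul_nonneg (mul_nonneg (ha0 x) (Real.rpow_nonneg hρx.le _)) (hσ0 x)
      have hy2 := mul_le_mul_of_nonneg_left hy hnn2
      rw [Real.mul_rpow hρx.le (abs_nonneg _)] at hy2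
      rw [Real.rpow_add hρx, Real.rpow_add hρx, Real.rpow_one]
      refine (le_of_eq ?_).trans (hy2.trans (le_of_eq ?_)) <;> ring
    · have h2 : x ∉ K := fun h => hx (hKU h)
      simp [hs_off x h2, hφ_off x h2, Real.zero_rpow hp0.ne']
  rw [integral_add (i1.const_mul _) (iR.const_mul _), integral_const_mul,
    integral_const_mul] at hY
  have e1 : ∫ x, a x * ρ x ^ α * σ x * |φ x| ^ p ∂g.vol =
      ∫ x, a x * ρ x ^ α * |φ x| ^ p * σ x ∂g.vol :=
    integral_congr_ae (Eventually.of_forall fun x => by simp only; ring)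
  have e2 : ∫ x, g.inner x (X x) (A x) * (ρ x ^ (α + 1) * θ x * σ x * |φ x| ^ p) ∂g.vol =
      ∫ x, ρ x ^ (α + 1) * |φ x| ^ p * (θ x * g.inner x (X x) (A x)) * σ x ∂g.vol :=
    integral_congr_ae (Eventually.of_forall fun x => by simp only; ring)
  rw [e1, e2, hCk] at hlim
  have hkp : 0 < k ^ (p - 1) := Real.rpow_pos_of_pos hk0 _
  have hkk : k ^ (p - 1) * k ^ (1 - p) = 1 := by
    rw [← Real.rpow_add hk0]; simp
  have hkk2 : k ^ p = k ^ (p - 1) * k := by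
    rw [← Real.rpow_add_one hk0.ne']; simp
  -- With I, J, R the integrals of the statement in the order I, J on the left and R on the right,
  -- this is pkI + J ≤ (p-1)kI + k^{1-p}R multiplied by k^{p-1}. Cancelling (p-1)kI leaves k^p I +
  -- k^{p-1}J ≤ R.
  have hfin := mul_le_mul_of_nonneg_left (hlim.trans hY) hkp.le
  rw [hkk2]
  linear_combination hfin + (∫ x, a x * ρ x ^ (α + p) * |s x| ^ p * σ x ∂g.vol) * hkk

end SmoothMetric

/-! ### The affine operators as weighted Riemannian ones. -/

namespace SmoothMetric

variable {n : ℕ} {M : Type*} [TopologicalSpace M]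
  [ChartedSpace (EuclideanSpace ℝ (Fin n)) M] [IsManifold (𝓡 n) ∞ M]

theorem inner_affineGrad (g : SmoothMetric n M) (u : M → ℝ) (lam mu : ℝ)
    (X Y : (x : M) → TangentSpace (𝓡 n) x) (x : M) :
    g.inner x (affineGrad u lam mu X x) (affineGrad u lam mu Y x) =
      Real.exp (2 * (mu - lam) * u x) * g.inner x (X x) (Y x) := by
  have h : Real.exp (2 * (mu - lam) * u x) =
      Real.exp (u x) ^ (mu - lam) * Real.exp (u x) ^ (mu - lam) := by
    rw [← Real.exp_mul, ← Real.exp_add]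
    ring_nf
  simp only [affineGrad, map_smul, _root_.smul_apply, smul_eq_mul, h]
  ring

theorem sq_vnorm (g : SmoothMetric n M) (x : M) (v : TangentSpace (𝓡 n) x) :
    g.vnorm x v ^ 2 = g.inner x v v := by
  refine Real.sq_sqrt ?_
  by_cases hv : v = 0
  · simp [hv]
  · exact (g.pos x v hv).le

/-- The normalization of the affine gradient fixes the Riemannian length as V^{λ-μ}, a continuous
function. This is the local bound on ∇ρ used by every approximation. -/
theorem vnorm_eq_of_vnorm_affineGrad_eq_one (g : SmoothMetric n M) (u : M → ℝ) (lam mu : ℝ)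
    (X : (x : M) → TangentSpace (𝓡 n) x) {x : M}
    (h : g.vnorm x (affineGrad u lam mu X x) = 1) :
    g.vnorm x (X x) = Real.exp ((lam - mu) * u x) := by
  have h1 := g.sq_vnorm x (affineGrad u lam mu X x)
  rw [h, inner_affineGrad, ← sq_vnorm] at h1
  refine (pow_left_inj₀ (Real.sqrt_nonneg _) (Real.exp_pos _).le two_ne_zero).1 ?_
  rw [← Real.exp_nat_mul]
  have h2 : Real.exp (((2 : ℕ) : ℝ) * ((lam - mu) * u x)) * Real.exp (2 * (mu - lam) * u x) = 1 := by
    rw [← Real.exp_add, Real.exp_eq_one_iff]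
    push_cast
    ring
  refine mul_right_cancel₀ (Real.exp_pos (2 * (mu - lam) * u x)).ne'
    (h2.trans ?_).symm
  exact (one_pow 2).symm.trans (h1.trans (mul_comm _ _))

theorem IsTestFunctionOn.exp_mul {U : Set M} {u P : M → ℝ} (hP : IsTestFunctionOn (n := n) U P)
    (hu : ContMDiff (𝓡 n) 𝓘(ℝ, ℝ) ∞ u) (r : ℝ) :
    IsTestFunctionOn (n := n) U (fun x => Real.exp (r * u x) * P x) :=
  ⟨((Real.contDiff_exp.comp (contDiff_const.mul contDiff_id)).contMDiff.comp hu).mul hP.1,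
    hP.2.1.mul_left, (tsupport_mul_subset_right).trans hP.2.2⟩

variable [MeasurableSpace M] [BorelSpace M] {g : SmoothMetric n M} {U : Set M}
  {X : (x : M) → TangentSpace (𝓡 n) x} {ρ N : M → ℝ}

/-- The constant 1 is locally integrable, so a locally bounded measurable function with compact
support needs no further integrable factor. -/
theorem integrable_of_isDominatedOn [SecondCountableTopology M] (hU : IsOpen U)
    {b : M → ℝ} (hb : IsDominatedOn g.vol U b) {K : Set M}
    (hK : IsCompact K) (hKU : K ⊆ U) (h0 : ∀ x, x ∉ K → b x = 0) : Integrable b g.vol := by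
  have h1 : LocallyIntegrableOn (fun _ : M => (1 : ℝ)) U g.vol :=
    g.locallyIntegrableOn_of_charts hU fun c => (locallyIntegrable_const 1).locallyIntegrableOn _
  simpa using integrable_mul_of_isDominatedOn hU h1 hb hK hKU h0

/-- The weight `exp (c u)` which makes the affine Laplacian a divergence. -/
theorem affineLaplacian_exp_mul [SecondCountableTopology M] (hU : IsOpen U)
    (hX : g.IsWeakGradOn U ρ X) (hN : ContinuousOn N U)
    (hXN : ∀ᵐ x ∂g.vol.restrict U, g.vnorm x (X x) ≤ N x) {u : M → ℝ}
    (hu : ContMDiff (𝓡 n) 𝓘(ℝ, ℝ) ∞ u) (lam mu : ℝ) {P : M → ℝ}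
    (hP : IsTestFunctionOn (n := n) U P) :
    g.affineLaplacian u lam mu X
        (fun x => Real.exp ((2 * mu + n * lam - (mu - lam)) * u x) * P x) =
      ∫ x, -(Real.exp ((2 * mu + n * lam) * u x) * g.inner x (X x) (g.grad P x)) ∂g.vol := by
  set c := 2 * mu + n * lam with hc
  have hexp : ∀ x, Real.exp (u x) ^ (mu - lam) * Real.exp ((c - (mu - lam)) * u x) =
      Real.exp (c * u x) := fun x => by
    rw [← Real.exp_mul, ← Real.exp_add]
    ring_nf
  have hE : Continuous fun x => Real.exp (c * u x) :=
    Real.continuous_exp.comp (continuous_const.mul hu.continuous)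
  -- With c = 2μ + nλ, the weight times V^{μ-λ} is V^c. The derivative of V^c yields c⟨∇u, X⟩, which
  -- cancels the first-order term of the affine Laplacian.
  have hEd : ∀ x, g.inner x (X x) (g.grad (fun y => Real.exp (c * u y) * P y) x) =
      Real.exp (c * u x) * g.inner x (X x) (g.grad P x) +
        c * (Real.exp (c * u x) * P x * g.inner x (X x) (g.grad u x)) := fun x => by
    have hF : HasDerivAt (fun t => Real.exp (c * t)) (Real.exp (c * u x) * c) (u x) := by
      simpa using ((hasDerivAt_id (u x)).const_mul c).exp
    have hEm : ContMDiff (𝓡 n) 𝓘(ℝ, ℝ) ∞ (fun x => Real.exp (c * u x)) :=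
      (Real.contDiff_exp.comp (contDiff_const.mul contDiff_id)).contMDiff.comp hu
    rw [g.inner_grad_mul (hEm.mdifferentiable (by simp) x) (hP.1.mdifferentiable (by simp) x),
      g.inner_grad_comp hF (hu.mdifferentiable (by simp) x)]
    ring
  have hUm := hU.measurableSet
  have i1 : Integrable (fun x => Real.exp (c * u x) * g.inner x (X x) (g.grad P x)) g.vol :=
    integrable_of_isDominatedOn hU ((hE.continuousOn.isDominatedOn hUm).mul
      (isDominatedOn_inner_grad hU hX hN hXN hP.1)) hP.2.1 hP.2.2
      fun x hx => by simp [g.inner_grad_eq_zero hx]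
  have i2 : Integrable (fun x => Real.exp (c * u x) * P x * g.inner x (X x) (g.grad u x)) g.vol :=
    integrable_of_isDominatedOn hU (((hE.mul hP.1.continuous).continuousOn.isDominatedOn hUm).mul
      (isDominatedOn_inner_grad hU hX hN hXN hu)) hP.2.1 hP.2.2
      fun x hx => by simp [image_eq_zero_of_notMem_tsupport hx]
  have e1 : ∀ x, Real.exp (u x) ^ (mu - lam) * g.inner x (g.grad u x) (X x) *
      (Real.exp ((c - (mu - lam)) * u x) * P x) =
      Real.exp (c * u x) * P x * g.inner x (X x) (g.grad u x) := fun x => by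
    rw [← hexp, g.symm x (g.grad u x)]
    ring
  rw [affineLaplacian]
  simp only [← mul_assoc, hexp] at e1 ⊢
  simp only [e1, hEd]
  rw [integral_add i1 (i2.const_mul c), integral_const_mul, integral_neg]
  ring

end SmoothMetric

end

theorem mainTheorem7 {n : ℕ} {M : Type*} [TopologicalSpace M] [T2Space M]
    [SecondCountableTopology M] [ChartedSpace (EuclideanSpace ℝ (Fin n)) M]
    [IsManifold (𝓡 n) ∞ M] [MeasurableSpace M] [BorelSpace M]
    (g : SmoothMetric n M)
    (u : M → ℝ) (hu : ContMDiff (𝓡 n) 𝓘(ℝ, ℝ) ∞ u)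
    (V : M → ℝ) (hV : V = fun x => Real.exp (u x))
    (lam mu τ : ℝ) (hτ : τ = (n + 1) * lam + mu)
    (C α p : ℝ) (hC : 1 < C) (hCα : 0 < C + α + 1) (hp : 1 < p)
    -- the weights, with their distributional gradients on the open set `Ω`
    (ρ a : M → ℝ) (hρ : Continuous ρ) (hρ0 : ∀ x, 0 ≤ ρ x) (ha0 : ∀ x, 0 ≤ a x)
    (Ω : Set M) (hΩ : Ω = (ρ ⁻¹' {0})ᶜ)
    (gradρ grada : (x : M) → TangentSpace (𝓡 n) x)
    (hgradρ : g.IsWeakGradOn Ω ρ gradρ) (hgrada : g.IsWeakGradOn Ω a grada)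
    -- `|∇^D ρ| = 1`
    (hnorm : ∀ᵐ x ∂g.vol.restrict Ω,
      g.vnorm x (SmoothMetric.affineGrad u lam mu gradρ x) = 1)
    -- `Δ^D ρ ≥ (C / ρ) V^{λ-μ}`
    (hlap : ∀ ψ : M → ℝ, SmoothMetric.IsTestFunctionOn (n := n) Ω ψ → (∀ x, 0 ≤ ψ x) →
      ∫ x, C / ρ x * V x ^ (lam - mu) * ψ x ∂g.vol ≤ g.affineLaplacian u lam mu gradρ ψ)
    -- `⟨∇^D ρ, ∇^D a⟩ ≥ 0`
    (hpos : ∀ᵐ x ∂g.vol.restrict Ω,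
      0 ≤ g.inner x (SmoothMetric.affineGrad u lam mu gradρ x)
        (SmoothMetric.affineGrad u lam mu grada x))
    (φ : M → ℝ) (hφ : SmoothMetric.IsTestFunctionOn (n := n) Ω φ) :
    Integrable (fun x => a x * ρ x ^ (α + p) *
        |g.inner x (SmoothMetric.affineGrad u lam mu gradρ x)
          (SmoothMetric.affineGrad u lam mu (g.grad φ) x)| ^ p *
        V x ^ (τ + lam - mu)) g.vol ∧
    Integrable (fun x => a x * ρ x ^ α * |φ x| ^ p * V x ^ (τ + lam - mu)) g.vol ∧
    Integrable (fun x => ρ x ^ (α + 1) * |φ x| ^ p *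
        g.inner x (SmoothMetric.affineGrad u lam mu gradρ x)
          (SmoothMetric.affineGrad u lam mu grada x) *
        V x ^ (τ + lam - mu)) g.vol ∧
    ((C + α + 1) / p) ^ p * (∫ x, a x * ρ x ^ α * |φ x| ^ p * V x ^ (τ + lam - mu) ∂g.vol) +
      ((C + α + 1) / p) ^ (p - 1) *
        (∫ x, ρ x ^ (α + 1) * |φ x| ^ p *
          g.inner x (SmoothMetric.affineGrad u lam mu gradρ x)
            (SmoothMetric.affineGrad u lam mu grada x) *
          V x ^ (τ + lam - mu) ∂g.vol) ≤
    ∫ x, a x * ρ x ^ (α + p) *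
        |g.inner x (SmoothMetric.affineGrad u lam mu gradρ x)
          (SmoothMetric.affineGrad u lam mu (g.grad φ) x)| ^ p *
        V x ^ (τ + lam - mu) ∂g.vol := by
  subst hV hτ
  have hU : IsOpen Ω := hΩ ▸ (isClosed_singleton.preimage hρ).isOpen_compl
  have hρpos : ∀ x ∈ Ω, 0 < ρ x := fun x hx => by
    rw [hΩ] at hx
    exact lt_of_le_of_ne (hρ0 x) fun h => hx h.symm
  have hcont : ∀ r : ℝ, Continuous fun x => Real.exp (r * u x) := fun r =>
    Real.continuous_exp.comp (continuous_const.mul hu.continuous)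
  have hN := (hcont (lam - mu)).continuousOn (s := Ω)
  have hXN : ∀ᵐ x ∂g.vol.restrict Ω, g.vnorm x (gradρ x) ≤ Real.exp ((lam - mu) * u x) :=
    hnorm.mono fun x hx => (g.vnorm_eq_of_vnorm_affineGrad_eq_one u lam mu gradρ hx).le
  simp only [SmoothMetric.inner_affineGrad]
  -- Applied with θ = V^{2(μ-λ)}, the factor by which affine gradients change the inner product, and
  -- σ = V^{τ+λ-μ}.
  refine SmoothMetric.hardy_inequality hU hgradρ hN hXN hgrada ha0 hρ.continuousOn hρpos
    (hcont (2 * (mu - lam))) ?_ (fun x => Real.rpow_nonneg (Real.exp_pos _).le _) ?_ hCα hp ?_ hφ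
  · simpa only [← Real.exp_mul, mul_comm] using hcont ((n + 1) * lam + mu + lam - mu)
  · filter_upwards [hnorm] with x hx
    rw [← SmoothMetric.inner_affineGrad, ← SmoothMetric.sq_vnorm, hx, one_pow]
  · intro P hP hP0
    -- The weight is chosen so that the affine Laplacian becomes the divergence of V^{2μ+nλ}∇ρ. The
    -- remaining goals match exponents: (λ-μ) + (2μ+nλ-(μ-λ)) = (n+2)λ = τ+λ-μ, and 2(μ-λ) + (n+2)λ
    -- = 2μ+nλ.
    have h := hlap _ (hP.exp_mul hu (2 * mu + n * lam - (mu - lam)))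
      fun x => mul_nonneg (Real.exp_pos _).le (hP0 x)
    rw [SmoothMetric.affineLaplacian_exp_mul hU hgradρ hN hXN hu lam mu hP] at h
    refine (le_of_eq (integral_congr_ae (Filter.Eventually.of_forall fun x => ?_))).trans
      (h.trans (le_of_eq (integral_congr_ae (Filter.Eventually.of_forall fun x => ?_))))
    · have h1 : Real.exp (u x) ^ ((n + 1) * lam + mu + lam - mu) =
          Real.exp (u x) ^ (lam - mu) * Real.exp ((2 * mu + n * lam - (mu - lam)) * u x) := by
        rw [← Real.exp_mul, ← Real.exp_mul, ← Real.exp_add]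
        ring_nf
      simp only [h1]
      ring
    · have h1 : Real.exp ((2 * mu + n * lam) * u x) = Real.exp (2 * (mu - lam) * u x) *
          Real.exp (u x) ^ ((n + 1) * lam + mu + lam - mu) := by
        rw [← Real.exp_mul, ← Real.exp_add]
        ring_nf
      simp only [h1]
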